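/- Let $V$ be a finite vocabulary and, for a token $e\in V$, write $\mathbf e\in\mathbb R^{|V|}$ for its one-hot vector. For width $d$, the linear RNN has parameters $\theta=(\mathbf v,\mathbf W^e,\mathbf W,\mathbf W^h)$ with $\mathbf v\in\mathbb R^d$, $\mathbf W^e\in\mathbb R^{d\times|V|}$, $\mathbf W,\mathbf W^h\in\mathbb R^{d\times d}$. On an instance $x=(e_1,\dots,e_T)$ its label score is $s^{(x)}(\theta)=\mathbf v^\top\mathbf h_T$, where $\mathbf h_0=0$ and $$\mathbf h_t=\tfrac1{\sqrt d}\mathbf W^h\mathbf h_{t-1}+\tfrac1d\mathbf W\mathbf W^e\mathbf e_t .$$ The label score of a token $e$ at distance $k\ge 0$ from the last token is $s^{e}_{[k]}(\theta)=\tfrac1d\mathbf v^\top\big(\tfrac{\mathbf W^h}{\sqrt d}\big)^{k}\mathbf W\mathbf W^e\mathbf e$. The neural tangent kernels (NTKs) are $$\Theta(x',x)=\big\langle\nabla_\theta s^{(x')},\nabla_\theta s^{(x)}\big\rangle,\qquad \Theta(e,k,x)=\big\langle\nabla_\theta s^{e}_{[k]},\nabla_\theta s^{(x)}\big\rangle .$$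 Let all entries of the parameters be initialized independently with $\mathbf W_{ij}\sim\mathcal N(0,\sigma_w^2)$, $\mathbf W^h_{ij}\sim\mathcal N(0,\sigma_h^2)$, $\mathbf W^e_{ij}\sim\mathcal N(0,\sigma_e^2)$, $\mathbf v_j\sim\mathcal N(0,\sigma_v^2)$. Then, as $d\to\infty$, the following hold for the NTKs at initialization. 1. For all instances $x'=(e'_1,\dots,e'_{T'})$ and $x=(e_1,\dots,e_T)$, $\Theta(x',x)$ converges in probability to the deterministic limit $$\begin{aligned}\Theta_\infty(x',x)={}&\sum_{k=0}^{\min(T',T)-1}\sigma_h^{2k}\sigma_e^2\sigma_w^2\,\mathbf e_{T'-k}'^{\top}\mathbf e_{T-k}+\sum_{k=0}^{\min(T',T)-1}\sigma_h^{2k}\sigma_v^2\sigma_w^2\,\mathbf e_{T'-k}'^{\top}\mathbf e_{T-k}\\&+\sum_{k=0}^{\min(T',T)-1}\sigma_h^{2k}\sigma_v^2\sigma_e^2\,\mathbf e_{T'-k}'^{\top}\mathbf e_{T-k}+\sum_{k=1}^{\min(T',T)-1}k\,\sigma_h^{2k-2}\sigma_v^2\sigma_w^2\sigma_e^2\,\mathbf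 e_{T'-k}'^{\top}\mathbf e_{T-k}.\end{aligned}$$ 2. For every token $e$, every integer $k\ge0$ and every instance $x=(e_1,\dots,e_T)$, $\Theta(e,k,x)$ converges in probability to the deterministic limit $$\Theta_\infty(e,k,x)=\rho(k)\,\mathbf e^\top\mathbf e_{T-k},$$ where $\rho(k)=\sigma_h^{2k}\sigma_e^2\sigma_w^2+\sigma_h^{2k}\sigma_v^2\sigma_w^2+\sigma_h^{2k}\sigma_v^2\sigma_e^2+k\,\sigma_h^{2k-2}\sigma_v^2\sigma_w^2\sigma_e^2$, the last term being $0$ for $k=0$, with $0^0=1$, and $\mathbf e_{T-k}:=0$ if $k\ge T$. -/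

import Mathlib

open MeasureTheory ProbabilityTheory Filter Topology
open scoped Matrix

noncomputable section

namespace LRNN

/-- Index set of all scalar parameters of a linear RNN of width `d` over the vocabulary `V`:
the entries of the output vector `v`, of the embedding matrix `Wᵉ` (`d × V`), of the input matrix
`W` (`d × d`) and of the recurrent matrix `Wʰ` (`d × d`), in this order. -/
abbrev ParamIdx (V : Type*) (d : ℕ) : Type _ :=
  Fin d ⊕ (Fin d × V) ⊕ (Fin d × Fin d) ⊕ (Fin d × Fin d)

/-- The vector `θ` of all parameters. -/
abbrev Params (V : Type*) (d : ℕ) : Type _ := ParamIdx V d → ℝ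

section Model

variable {V : Type*} {d : ℕ}

/-- The output vector `v`. -/
def outVec (θ : Params V d) : Fin d → ℝ := fun i => θ (Sum.inl i)

/-- The embedding matrix `Wᵉ`. -/
def embMat (θ : Params V d) : Matrix (Fin d) V ℝ :=
  Matrix.of fun i a => θ (Sum.inr (Sum.inl (i, a)))

/-- The input matrix `W`. -/
def inMat (θ : Params V d) : Matrix (Fin d) (Fin d) ℝ :=
  Matrix.of fun i j => θ (Sum.inr (Sum.inr (Sum.inl (i, j))))

/-- The recurrent matrix `Wʰ`. -/
def recMat (θ : Params V d) : Matrix (Fin d) (Fin d) ℝ :=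
  Matrix.of fun i j => θ (Sum.inr (Sum.inr (Sum.inr (i, j))))

end Model

/-- The one-hot vector of a token. -/
def oneHot {V : Type*} [DecidableEq V] (a : V) : V → ℝ := Pi.single a 1

/-- The one-hot vector `e_{T-k}` of the token at distance `k` from the last token of the instance
`x = (x 0, …, x (T-1))` of length `T`, with the zero vector when there is no such token. -/
def oneHotFromEnd {V : Type*} [DecidableEq V] {T : ℕ} (x : Fin T → V) (k : ℕ) : V → ℝ :=
  if h : k < T then oneHot (x ⟨T - 1 - k, by omega⟩) else 0

section Model

variable {V : Type*} [Fintype V] [DecidableEq V] {d : ℕ}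

/-- The hidden state after reading all tokens of `x`: `h_0 = 0` and
`h_t = (1/√d) Wʰ h_{t-1} + (1/d) W Wᵉ e_t`. -/
def hidden (θ : Params V d) : {T : ℕ} → (Fin T → V) → (Fin d → ℝ)
  | 0, _ => 0
  | t + 1, x =>
      (1 / Real.sqrt d) • (recMat θ *ᵥ hidden θ (fun i : Fin t => x i.castSucc))
        + (1 / (d : ℝ)) • (inMat θ *ᵥ (embMat θ *ᵥ oneHot (x (Fin.last t))))

/-- The label score `s = vᵀ h_T` of the instance `x`. -/
def score {T : ℕ} (x : Fin T → V) (θ : Params V d) : ℝ := outVec θ ⬝ᵥ hidden θ x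

/-- The label score `(1/d) vᵀ (Wʰ/√d)^k W Wᵉ e` of the token `e` at distance `k` from the
last token. -/
def tokenScore (e : V) (k : ℕ) (θ : Params V d) : ℝ :=
  (1 / (d : ℝ)) *
    (outVec θ ⬝ᵥ
      ((((1 / Real.sqrt d) • recMat θ) ^ k) *ᵥ (inMat θ *ᵥ (embMat θ *ᵥ oneHot e))))

end Model

/-- The neural tangent kernel `⟨∇_θ f, ∇_θ g⟩ = ∑_p (∂f/∂θ_p) (∂g/∂θ_p)` of two scalar outputs
of the parameters. -/
def ntk {ι : Type*} [Fintype ι] [DecidableEq ι] (f g : (ι → ℝ) → ℝ) (θ : ι → ℝ) : ℝ :=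
  ∑ p, fderiv ℝ f θ (Pi.single p 1) * fderiv ℝ g θ (Pi.single p 1)

/-- The standard deviation at initialization of each scalar parameter. -/
def initStd {V : Type*} {d : ℕ} (σv σe σw σh : ℝ) : ParamIdx V d → ℝ
  | Sum.inl _ => σv
  | Sum.inr (Sum.inl _) => σe
  | Sum.inr (Sum.inr (Sum.inl _)) => σw
  | Sum.inr (Sum.inr (Sum.inr _)) => σh

/-- The law of the parameters at initialization: independent centred Gaussians. -/
def initLaw (V : Type*) [Fintype V] (σv σe σw σh : ℝ) (d : ℕ) : Measure (Params V d) :=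
  Measure.pi fun p => gaussianReal 0 (Real.toNNReal ((initStd σv σe σw σh p) ^ 2))

/-- For every width `d` the parameters are drawn from `P d`; the random quantities `X d` converge
in probability, as `d → ∞`, to the deterministic number `c`. -/
def ConvergesInProb {Ω : ℕ → Type*} [∀ d, MeasurableSpace (Ω d)] (P : ∀ d, Measure (Ω d))
    (X : ∀ d, Ω d → ℝ) (c : ℝ) : Prop :=
  ∀ ε : ℝ, 0 < ε → Tendsto (fun d => P d {ω | ε ≤ |X d ω - c|}) atTop (𝓝 0)

/-- The coefficient `ρ(k)`. The truncated subtraction in the last exponent only matters for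
`k = 0`, where the last term vanishes because of its factor `k`. -/
def rho (σv σe σw σh : ℝ) (k : ℕ) : ℝ :=
  σh ^ (2 * k) * σe ^ 2 * σw ^ 2 + σh ^ (2 * k) * σv ^ 2 * σw ^ 2
    + σh ^ (2 * k) * σv ^ 2 * σe ^ 2
    + (k : ℝ) * σh ^ (2 * k - 2) * σv ^ 2 * σw ^ 2 * σe ^ 2

end LRNN

end

/-! A score is a sum of terms `(1/d) vᵀ (Wʰ/√d)^k W Wᵉ e`, polynomial in the parameters, so by
bilinearity it suffices to find the limit of the kernel of two such terms. Each is a bilinear form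
of a word in the rescaled matrices `Wʰ/√d`, `W/√d`. Differentiating in `v` or `Wᵉ` leaves one
normalized bilinear form. Differentiating in a matrix entry cuts the word at an occurrence of that
matrix and gives a rank-one gradient, so each pair of equal letters contributes a product of two
forms (`polyNTK_wordPoly`).

These forms concentrate. Integrating out the Gaussian vectors turns their first two moments into
expected products of normalized traces, up to terms of order `1/d`. Gaussian integration by parts
gives the loop equation `IsGaussianFamily.exp_traceProd_cons` for such products: splitting a word
into two has order one, every other term carries a factor `1/d`. Induction on size
(`tendsto_prod_freeMoment`) yields products of moments of free circular variables, so the second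
moment tends to the square of the limiting mean, and Chebyshev's inequality gives convergence in
probability (`convergesInProb_wordForm`).

The words that occur are `w w'ᵀ` or `wᵀ w'` with `w`, `w'` free of transposes. Only the fully nested
pairing survives, so the moment is the product of variances if `w = w'` and zero otherwise
(`freeMoment_append_wordAdj`). Hence only equal tokens at equal distances contribute: the gradients
in `v`, `Wᵉ` and `W` give the first three terms of `rho`, and the `k` copies of `Wʰ` give the last.
-/

noncomputable section

namespace LRNN

/-! ### Gaussian integration by parts for polynomials -/

section Gaussian

open scoped NNReal

lemma integrable_pow_gaussianReal (m : ℝ) (v : ℝ≥0) (n : ℕ) :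
    Integrable (fun x : ℝ => x ^ n) (gaussianReal m v) := by
  have h := (memLp_id_gaussianReal (μ := m) (v := v) n).integrable_norm_pow'
  refine (integrable_norm_iff (by fun_prop)).1 ?_
  simpa using h

lemma hasDerivAt_gaussianPDFReal {v : ℝ≥0} (hv : v ≠ 0) (x : ℝ) :
    HasDerivAt (gaussianPDFReal 0 v) (-(x / v) * gaussianPDFReal 0 v x) x := by
  have hv' : (v : ℝ) ≠ 0 := by exact_mod_cast hv
  rw [gaussianPDFReal_def]
  have h1 : HasDerivAt (fun y : ℝ => -(y - 0) ^ 2 / (2 * (v : ℝ))) (-(x / v)) x := by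
    have := (((hasDerivAt_id x).sub_const 0).pow 2).neg.div_const (2 * (v : ℝ))
    refine this.congr_deriv ?_
    simp only [id_eq, sub_zero, Nat.cast_ofNat, Nat.add_one_sub_one, pow_one, mul_one]
    field_simp
  refine (h1.exp.const_mul ((Real.sqrt (2 * Real.pi * v))⁻¹)).congr_deriv ?_
  ring

lemma integrable_pow_mul_gaussianPDFReal {v : ℝ≥0} (hv : v ≠ 0) (n : ℕ) :
    Integrable (fun x : ℝ => x ^ n * gaussianPDFReal 0 v x) := by
  have h := integrable_pow_gaussianReal 0 v n
  rw [gaussianReal_of_var_ne_zero _ hv, integrable_withDensity_iff_integrable_smul₀'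
    (measurable_gaussianPDF _ _).aemeasurable
    (Eventually.of_forall fun _ => gaussianPDF_lt_top)] at h
  refine h.congr (Eventually.of_forall fun x => ?_)
  simp only [toReal_gaussianPDF, smul_eq_mul, mul_comm]

/-- Moment recursion of the centred Gaussian. -/
lemma integral_pow_succ_gaussianReal (v : ℝ≥0) (n : ℕ) :
    ∫ x, x ^ (n + 1) ∂gaussianReal 0 v = v * (n * ∫ x, x ^ (n - 1) ∂gaussianReal 0 v) := by
  -- Zero variance gives a Dirac mass, which has no density; both sides are then zero.
  by_cases hv : v = 0
  · subst hv
    simp [gaussianReal_zero_var]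
  have hv' : (v : ℝ) ≠ 0 := by exact_mod_cast hv
  rw [integral_gaussianReal_eq_integral_smul hv, integral_gaussianReal_eq_integral_smul hv]
  have key := integral_mul_deriv_eq_deriv_mul_of_integrable (A := ℝ)
    (u := fun x : ℝ => x ^ n) (v := gaussianPDFReal 0 v)
    (u' := fun x => n * x ^ (n - 1)) (v' := fun x => -(x / v) * gaussianPDFReal 0 v x)
    (fun x _ => hasDerivAt_pow n x) (fun x _ => hasDerivAt_gaussianPDFReal hv x)
    (by
      refine ((integrable_pow_mul_gaussianPDFReal hv (n + 1)).const_mul (-(v : ℝ)⁻¹)).congr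
        (Eventually.of_forall fun x => ?_)
      simp only [Pi.mul_apply]
      ring)
    (by
      refine ((integrable_pow_mul_gaussianPDFReal hv (n - 1)).const_mul (n : ℝ)).congr
        (Eventually.of_forall fun x => ?_)
      simp only [Pi.mul_apply]
      ring)
    (integrable_pow_mul_gaussianPDFReal hv n)
  have e1 : ∫ x : ℝ, x ^ n * (-(x / v) * gaussianPDFReal 0 v x)
      = -(v : ℝ)⁻¹ * ∫ x : ℝ, gaussianPDFReal 0 v x • x ^ (n + 1) := by
    rw [← integral_const_mul]
    congr 1; ext x
    simp only [smul_eq_mul]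
    ring
  have e2 : ∫ x : ℝ, n * x ^ (n - 1) * gaussianPDFReal 0 v x
      = n * ∫ x : ℝ, gaussianPDFReal 0 v x • x ^ (n - 1) := by
    rw [← integral_const_mul]
    congr 1; ext x
    simp only [smul_eq_mul]
    ring
  rw [e1, e2] at key
  field_simp at key
  linarith

variable {ι : Type*} [Fintype ι]

lemma integrable_eval_pi_gaussianReal (v : ι → ℝ≥0) (P : MvPolynomial ι ℝ) :
    Integrable (fun θ : ι → ℝ => MvPolynomial.eval θ P)
      (Measure.pi fun p => gaussianReal 0 (v p)) := by
  induction P using MvPolynomial.induction_on' with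
  | monomial u a =>
    simp only [MvPolynomial.eval_monomial]
    refine Integrable.const_mul ?_ a
    simp only [Finsupp.prod_fintype, pow_zero, implies_true]
    exact Integrable.fintype_prod_dep fun i => integrable_pow_gaussianReal 0 (v i) (u i)
  | add P Q hP hQ =>
    simp only [map_add]
    exact hP.add hQ

/-- Expectation of a polynomial in independent centred Gaussians of variances `v`. -/
def gaussExp (v : ι → ℝ≥0) : MvPolynomial ι ℝ →ₗ[ℝ] ℝ where
  toFun P := ∫ θ, MvPolynomial.eval θ P ∂(Measure.pi fun p => gaussianReal 0 (v p))
  map_add' P Q := by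
    simp only [map_add]
    exact integral_add (integrable_eval_pi_gaussianReal v P) (integrable_eval_pi_gaussianReal v Q)
  map_smul' a P := by
    simp only [MvPolynomial.smul_eval, RingHom.id_apply, smul_eq_mul, integral_const_mul]

lemma gaussExp_one (v : ι → ℝ≥0) : gaussExp v 1 = 1 := by
  simp [gaussExp]

lemma gaussExp_monomial (v : ι → ℝ≥0) (u : ι →₀ ℕ) (a : ℝ) :
    gaussExp v (MvPolynomial.monomial u a) = a * ∏ i, ∫ x, x ^ u i ∂gaussianReal 0 (v i) := by
  simp only [gaussExp, LinearMap.coe_mk, AddHom.coe_mk, MvPolynomial.eval_monomial,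
    integral_const_mul]
  congr 1
  simp only [Finsupp.prod_fintype, pow_zero, implies_true]
  exact integral_fintype_prod_eq_prod (fun i (x : ℝ) => x ^ u i)

/-- Gaussian integration by parts for polynomials. -/
lemma gaussExp_X_mul (v : ι → ℝ≥0) (p : ι) (P : MvPolynomial ι ℝ) :
    gaussExp v (MvPolynomial.X p * P) = v p * gaussExp v (MvPolynomial.pderiv p P) := by
  classical
  induction P using MvPolynomial.induction_on' with
  | monomial u a =>
    have hX : MvPolynomial.X p * MvPolynomial.monomial u a
        = MvPolynomial.monomial (u + Finsupp.single p 1) a := by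
      rw [MvPolynomial.monomial_add_single, pow_one, mul_comm]
    rw [MvPolynomial.pderiv_monomial, hX]
    simp only [gaussExp_monomial]
    -- Moments factor over coordinates, and only the factor at `p` changes; it obeys the
    -- one-dimensional recursion.
    rw [← Finset.mul_prod_erase Finset.univ _ (Finset.mem_univ p),
      ← Finset.mul_prod_erase Finset.univ (fun i => ∫ x, x ^ ((u - Finsupp.single p 1 : ι →₀ ℕ) i)
        ∂gaussianReal 0 (v i)) (Finset.mem_univ p)]
    have h : ∀ i ∈ Finset.univ.erase p, ∫ x, x ^ ((u + Finsupp.single p 1 : ι →₀ ℕ) i) ∂gaussianReal 0 (v i)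
        = ∫ x, x ^ ((u - Finsupp.single p 1 : ι →₀ ℕ) i) ∂gaussianReal 0 (v i) := by
      intro i hi
      have : p ≠ i := (Finset.ne_of_mem_erase hi).symm
      simp [Finsupp.single_eq_of_ne, this.symm]
    rw [Finset.prod_congr rfl h]
    simp only [Finsupp.add_apply, Finsupp.single_eq_same, Finsupp.tsub_apply,
      integral_pow_succ_gaussianReal]
    ring
  | add P Q hP hQ =>
    simp only [mul_add, map_add, hP, hQ]

/-- Replaces analytic gradients by formal ones, so that the kernel of two polynomials is again a
polynomial (`ntk_eval`). -/
lemma hasFDerivAt_eval (P : MvPolynomial ι ℝ) (θ : ι → ℝ) :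
    HasFDerivAt (fun θ : ι → ℝ => MvPolynomial.eval θ P)
      (∑ p, MvPolynomial.eval θ (MvPolynomial.pderiv p P) •
        (ContinuousLinearMap.proj p : (ι → ℝ) →L[ℝ] ℝ)) θ := by
  classical
  induction P using MvPolynomial.induction_on with
  | C a =>
    simpa using hasFDerivAt_const a θ
  | add P Q hP hQ =>
    simp only [map_add, add_smul, Finset.sum_add_distrib]
    exact hP.add hQ
  | mul_X P i hP =>
    have h := hP.mul (ContinuousLinearMap.proj (R := ℝ) (φ := fun _ : ι => ℝ) i).hasFDerivAt
      (x := θ)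
    simp only [map_mul, MvPolynomial.eval_X]
    refine h.congr_fderiv ?_
    ext w
    simp only [_root_.add_apply, _root_.smul_apply,
      ContinuousLinearMap.proj_apply, _root_.sum_apply, smul_eq_mul,
      MvPolynomial.pderiv_mul, MvPolynomial.pderiv_X, map_add, map_mul, MvPolynomial.eval_X,
      add_mul, Finset.sum_add_distrib, Finset.mul_sum]
    rw [add_comm]
    congr 1
    · exact Finset.sum_congr rfl fun _ _ => by ring
    · rw [Finset.sum_eq_single i]
      · simp
      · intro b _ hb
        simp [hb.symm]
      · simp

lemma ntk_eval [DecidableEq ι] (P Q : MvPolynomial ι ℝ) (θ : ι → ℝ) :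
    ntk (fun θ => MvPolynomial.eval θ P) (fun θ => MvPolynomial.eval θ Q) θ
      = MvPolynomial.eval θ (∑ p, MvPolynomial.pderiv p P * MvPolynomial.pderiv p Q) := by
  simp only [ntk, (hasFDerivAt_eval _ θ).fderiv, map_sum, map_mul]
  refine Finset.sum_congr rfl fun p _ => ?_
  simp [Pi.single_apply]

end Gaussian

/-! ### Convergence in probability -/

section InProbability

variable {Ω : ℕ → Type*} [∀ d, MeasurableSpace (Ω d)] {P : ∀ d, Measure (Ω d)}

lemma ConvergesInProb.congr {X Y : ∀ d, Ω d → ℝ} {c : ℝ} (hX : ConvergesInProb P X c)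
    (h : ∀ᶠ d in atTop, ∀ ω, X d ω = Y d ω) : ConvergesInProb P Y c := by
  intro ε hε
  refine (hX ε hε).congr' ?_
  filter_upwards [h] with d hd
  simp [hd]

lemma convergesInProb_const (c : ℝ) : ConvergesInProb P (fun _ _ => c) c := by
  intro ε hε
  have : ∀ d, {ω : Ω d | ε ≤ |c - c|} = ∅ := by
    intro d; ext; simp [hε]
  simp only [this, measure_empty, tendsto_const_nhds]

/-- Continuity at `(a, b)` places the bad event for `f` inside the union of the bad events for `X`
and `Y`, so no joint law is needed. -/
lemma ConvergesInProb.map₂ {X Y : ∀ d, Ω d → ℝ} {a b : ℝ} (hX : ConvergesInProb P X a)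
    (hY : ConvergesInProb P Y b) {f : ℝ × ℝ → ℝ} (hf : ContinuousAt f (a, b)) :
    ConvergesInProb P (fun d ω => f (X d ω, Y d ω)) (f (a, b)) := by
  intro ε hε
  obtain ⟨δ, hδ, h⟩ := Metric.continuousAt_iff.1 hf ε hε
  have hsum := (hX δ hδ).add (hY δ hδ)
  rw [add_zero] at hsum
  refine tendsto_of_tendsto_of_tendsto_of_le_of_le tendsto_const_nhds hsum
    (fun _ => zero_le) fun d => ?_
  refine (measure_mono ?_).trans (measure_union_le _ _)
  intro ω hω
  by_contra hcon
  simp only [Set.mem_union, Set.mem_ofPred_eq, not_or, not_le] at hcon hω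
  have := h (x := (X d ω, Y d ω)) (by
    rw [Prod.dist_eq]
    exact max_lt (by simpa [Real.dist_eq] using hcon.1) (by simpa [Real.dist_eq] using hcon.2))
  rw [Real.dist_eq] at this
  linarith

lemma ConvergesInProb.add {X Y : ∀ d, Ω d → ℝ} {a b : ℝ} (hX : ConvergesInProb P X a)
    (hY : ConvergesInProb P Y b) : ConvergesInProb P (fun d ω => X d ω + Y d ω) (a + b) :=
  hX.map₂ hY (f := fun p => p.1 + p.2) (by fun_prop)

lemma ConvergesInProb.mul {X Y : ∀ d, Ω d → ℝ} {a b : ℝ} (hX : ConvergesInProb P X a)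
    (hY : ConvergesInProb P Y b) : ConvergesInProb P (fun d ω => X d ω * Y d ω) (a * b) :=
  hX.map₂ hY (f := fun p => p.1 * p.2) (by fun_prop)

lemma convergesInProb_sum {α : Type*} (s : Finset α) {X : α → ∀ d, Ω d → ℝ} {c : α → ℝ}
    (h : ∀ i ∈ s, ConvergesInProb P (X i) (c i)) :
    ConvergesInProb P (fun d ω => ∑ i ∈ s, X i d ω) (∑ i ∈ s, c i) := by
  classical
  induction s using Finset.induction_on with
  | empty => simpa using convergesInProb_const 0
  | insert i s hi ih =>
    simp only [Finset.sum_insert hi]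
    exact (h i (Finset.mem_insert_self i s)).add
      (ih fun j hj => h j (Finset.mem_insert_of_mem hj))

/-- Convergence of the first two moments to those of a constant gives convergence in
probability. -/
lemma convergesInProb_of_moments [∀ d, IsProbabilityMeasure (P d)] {X : ∀ d, Ω d → ℝ} {c : ℝ}
    (hX : ∀ d, Integrable (X d) (P d)) (hX2 : ∀ d, Integrable (fun ω => X d ω ^ 2) (P d))
    (h1 : Tendsto (fun d => ∫ ω, X d ω ∂P d) atTop (𝓝 c))
    (h2 : Tendsto (fun d => ∫ ω, X d ω ^ 2 ∂P d) atTop (𝓝 (c ^ 2))) :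
    ConvergesInProb P X c := by
  intro ε hε
  have hint : ∀ d, Integrable (fun ω => (X d ω - c) ^ 2) (P d) := fun d =>
    (((hX2 d).sub ((hX d).const_mul (2 * c))).add (integrable_const (c ^ 2))).congr
      (Eventually.of_forall fun ω => by simp only [Pi.add_apply, Pi.sub_apply]; ring)
  have heq : ∀ d, ∫ ω, (X d ω - c) ^ 2 ∂P d
      = ∫ ω, X d ω ^ 2 ∂P d - 2 * c * ∫ ω, X d ω ∂P d + c ^ 2 := by
    intro d
    have : ∀ ω, (X d ω - c) ^ 2 = X d ω ^ 2 - 2 * c * X d ω + c ^ 2 := fun ω => by ring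
    simp only [this]
    have hs : Integrable (fun ω => X d ω ^ 2 - 2 * c * X d ω) (P d) :=
      (hX2 d).sub ((hX d).const_mul (2 * c))
    rw [integral_add hs (integrable_const _),
      integral_sub (hX2 d) ((hX d).const_mul (2 * c)), integral_const_mul]
    simp
  have hlim : Tendsto (fun d => ∫ ω, (X d ω - c) ^ 2 ∂P d) atTop (𝓝 0) := by
    simp only [heq]
    have := (h2.sub (h1.const_mul (2 * c))).add_const (c ^ 2)
    convert this using 2
    ring
  have hreal : Tendsto (fun d => (P d).real {ω | ε ≤ |X d ω - c|}) atTop (𝓝 0) := by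
    have hb := hlim.const_mul ((ε ^ 2)⁻¹)
    rw [mul_zero] at hb
    refine tendsto_of_tendsto_of_tendsto_of_le_of_le tendsto_const_nhds hb
      (fun _ => measureReal_nonneg) fun d => ?_
    -- Chebyshev's inequality about the limit `c` instead of the mean.
    have hM := mul_meas_ge_le_integral_of_nonneg
      (Eventually.of_forall fun ω => sq_nonneg (X d ω - c)) (hint d) (ε ^ 2)
    have hset : {ω | ε ^ 2 ≤ (X d ω - c) ^ 2} = {ω | ε ≤ |X d ω - c|} := by
      ext ω
      simp only [Set.mem_ofPred_eq, sq_le_sq, abs_of_pos hε]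
    rw [hset] at hM
    rw [inv_mul_eq_div, le_div_iff₀ (by positivity), mul_comm]
    exact hM
  have := (ENNReal.tendsto_ofReal hreal)
  simpa [ofReal_measureReal] using this

end InProbability

/-! ### Words in Gaussian matrices and the loop equation -/

section Words

variable {C : Type*}

/-- A letter `(c, t)` stands for the matrix named `c`, transposed if `t = true`. -/
abbrev Letter (C : Type*) : Type _ := C × Bool

/-- The letter of the transposed matrix. -/
def Letter.adj (x : Letter C) : Letter C := (x.1, !x.2)

lemma Letter.adj_adj (x : Letter C) : x.adj.adj = x := by simp [Letter.adj]

/-- The word of the transposed product. -/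
def wordAdj (w : List (Letter C)) : List (Letter C) := (w.map Letter.adj).reverse

@[simp] lemma wordAdj_length (w : List (Letter C)) : (wordAdj w).length = w.length := by
  simp [wordAdj]

variable {R : Type*} {d : ℕ}

/-- The matrix of a letter. -/
def letterMat (A : C → Matrix (Fin d) (Fin d) R) (x : Letter C) : Matrix (Fin d) (Fin d) R :=
  if x.2 then (A x.1)ᵀ else A x.1

lemma letterMat_adj (A : C → Matrix (Fin d) (Fin d) R) (x : Letter C) :
    letterMat A x.adj = (letterMat A x)ᵀ := by
  obtain ⟨c, t⟩ := x
  cases t <;> simp [letterMat, Letter.adj]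

variable [CommRing R]

/-- The matrix of a word. -/
def wordMat (A : C → Matrix (Fin d) (Fin d) R) (w : List (Letter C)) :
    Matrix (Fin d) (Fin d) R :=
  (w.map (letterMat A)).prod

variable (A : C → Matrix (Fin d) (Fin d) R)

lemma wordMat_nil : wordMat A [] = 1 := rfl

lemma wordMat_cons (x : Letter C) (w : List (Letter C)) :
    wordMat A (x :: w) = letterMat A x * wordMat A w := by
  simp [wordMat]

lemma wordMat_append (u w : List (Letter C)) :
    wordMat A (u ++ w) = wordMat A u * wordMat A w := by
  simp [wordMat]

lemma map_wordMat {S : Type*} [CommRing S] (f : R →+* S) (w : List (Letter C)) :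
    (wordMat A w).map f = wordMat (fun c => (A c).map f) w := by
  induction w with
  | nil => simp [wordMat_nil]
  | cons x w ih =>
    rw [wordMat_cons, wordMat_cons, Matrix.map_mul, ih]
    obtain ⟨c, t⟩ := x
    cases t <;> simp [letterMat, Matrix.transpose_map]

lemma wordMat_wordAdj (w : List (Letter C)) : wordMat A (wordAdj w) = (wordMat A w)ᵀ := by
  induction w with
  | nil => simp [wordAdj, wordMat]
  | cons x w ih =>
    have : wordAdj (x :: w) = wordAdj w ++ [x.adj] := by simp [wordAdj]
    rw [this, wordMat_append, ih, wordMat_cons, wordMat_cons, wordMat_nil, mul_one,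
      letterMat_adj, Matrix.transpose_mul]

/-- This index contraction and the next glue `U` into a trace cut open at one letter: here with
reversed orientation, there with the original one. -/
lemma sum_mul_trace_transpose (U W₁ W₂ : Matrix (Fin d) (Fin d) R) :
    ∑ i, ∑ j, U j i * ∑ k, W₁ k i * W₂ j k = (Uᵀ * (W₂ * W₁)).trace := by
  simp only [Matrix.trace, Matrix.diag, Matrix.mul_apply, Matrix.transpose_apply, mul_comm]

lemma sum_mul_trace (U W₁ W₂ : Matrix (Fin d) (Fin d) R) :
    ∑ i, ∑ j, U j i * ∑ k, W₁ k j * W₂ i k = (W₁ * (U * W₂)).trace := by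
  rw [Matrix.trace_mul_comm, Matrix.mul_assoc, Matrix.trace_mul_comm, Matrix.mul_assoc]
  simp only [Matrix.trace, Matrix.diag, Matrix.mul_apply]
  refine Finset.sum_congr rfl fun i _ => ?_
  simp only [Finset.mul_sum]
  rw [Finset.sum_comm]
  refine Finset.sum_congr rfl fun k _ => Finset.sum_congr rfl fun j _ => by ring

variable [Algebra ℝ R]

/-- Normalized trace of a word. -/
def wordTrace (w : List (Letter C)) : R := (d : ℝ)⁻¹ • (wordMat A w).trace

/-- Product of normalized traces. -/
def traceProd (L : List (List (Letter C))) : R := (L.map (wordTrace A)).prod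

lemma traceProd_cons (w : List (Letter C)) (L : List (List (Letter C))) :
    traceProd A (w :: L) = wordTrace A w * traceProd A L := by
  simp [traceProd]

lemma trace_wordMat (hd : d ≠ 0) (w : List (Letter C)) :
    (wordMat A w).trace = (d : ℝ) • wordTrace A w := by
  rw [wordTrace, smul_smul, mul_inv_cancel₀ (by exact_mod_cast hd), one_smul]

lemma wordTrace_nil (hd : d ≠ 0) : wordTrace A [] = 1 := by
  have : ((d : ℕ) : R) = (d : ℝ) • (1 : R) := by
    rw [Algebra.smul_def, mul_one, map_natCast]
  rw [wordTrace, wordMat_nil, Matrix.trace_one, Fintype.card_fin, this, smul_smul,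
    inv_mul_cancel₀ (by exact_mod_cast hd), one_smul]

variable [DecidableEq C]

/-- Derivation in the direction of an entry of the matrix of a letter. -/
def letterDer (D : C → Fin d → Fin d → Derivation ℝ R R) (x : Letter C) (i j : Fin d) :
    Derivation ℝ R R :=
  if x.2 then D x.1 j i else D x.1 i j

/-- `E` is an expectation for which the matrices `A c` of size `d` have independent centred
Gaussian entries of variance `σ c ^ 2 / d`, expressed by Gaussian integration by parts;
`D c i j` is `1 / d` times the derivative in the `(i, j)` entry of `A c`. -/
structure IsGaussianFamily (σ : C → ℝ) (A : C → Matrix (Fin d) (Fin d) R) (E : R →ₗ[ℝ] ℝ)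
    (D : C → Fin d → Fin d → Derivation ℝ R R) : Prop where
  exp_one : E 1 = 1
  exp_mul : ∀ c i j F, E (A c i j * F) = σ c ^ 2 * E (D c i j F)
  deriv_apply : ∀ c i j c' k l, D c i j (A c' k l)
    = (d : ℝ)⁻¹ • if c' = c ∧ k = i ∧ l = j then (1 : R) else 0

variable {A} {σ : C → ℝ} {E : R →ₗ[ℝ] ℝ} {D : C → Fin d → Fin d → Derivation ℝ R R}

lemma IsGaussianFamily.exp_letterMat_mul (h : IsGaussianFamily σ A E D) (x : Letter C)
    (i j : Fin d) (F : R) :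
    E (letterMat A x i j * F) = σ x.1 ^ 2 * E (letterDer D x i j F) := by
  obtain ⟨c, t⟩ := x
  cases t <;> simp [letterMat, letterDer, h.exp_mul]

/-- A matrix and its transpose share entries with swapped indices, hence two ways for `y` to depend
on an entry of `x`. -/
lemma IsGaussianFamily.letterDer_letterMat (h : IsGaussianFamily σ A E D) (x y : Letter C)
    (i j k l : Fin d) :
    letterDer D x i j (letterMat A y k l)
      = (d : ℝ)⁻¹ • ((if y = x then (if k = i then 1 else 0) * (if l = j then 1 else 0) else 0)
        + if y = x.adj then (if k = j then 1 else 0) * (if l = i then 1 else 0) else 0) := by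
  obtain ⟨c, t⟩ := x
  obtain ⟨c', t'⟩ := y
  by_cases hc : c' = c <;> cases t <;> cases t' <;>
    simp [letterMat, letterDer, h.deriv_apply, Letter.adj, hc, ← ite_and, and_comm]

/-- Leibniz rule: each occurrence of `x` or its transpose is deleted in turn, leaving a prefix and a
suffix with the freed indices. -/
lemma IsGaussianFamily.letterDer_wordMat (h : IsGaussianFamily σ A E D) (x : Letter C)
    (i j : Fin d) (w : List (Letter C)) (k l : Fin d) :
    letterDer D x i j (wordMat A w k l) = (d : ℝ)⁻¹ • ∑ n : Fin w.length,
      ((if w[n] = x then wordMat A (w.take n) k i * wordMat A (w.drop (n + 1)) j l else 0)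
      + if w[n] = x.adj then wordMat A (w.take n) k j * wordMat A (w.drop (n + 1)) i l
        else 0) := by
  induction w generalizing k with
  | nil =>
    by_cases hkl : k = l <;> simp [wordMat_nil, Matrix.one_apply, hkl]
  | cons y w ih =>
    rw [wordMat_cons, Matrix.mul_apply, map_sum]
    simp only [Derivation.leibniz, ih, h.letterDer_letterMat]
    rw [Finset.sum_add_distrib, add_comm]
    simp only [List.length_cons]
    rw [Fin.sum_univ_succ, smul_add]
    congr 1
    · simp only [smul_eq_mul, mul_smul_comm, ← Finset.smul_sum]
      congr 1
      by_cases h1 : y = x <;> by_cases h2 : y = x.adj <;>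
        simp [h1, h2, wordMat_nil, Matrix.one_apply, mul_add, Finset.sum_add_distrib, eq_comm]
    · simp only [smul_eq_mul, mul_smul_comm, ← Finset.smul_sum]
      congr 1
      simp only [Finset.mul_sum]
      rw [Finset.sum_comm]
      refine Finset.sum_congr rfl fun n _ => ?_
      simp [wordMat_cons, Matrix.mul_apply, Finset.sum_mul, mul_add, Finset.sum_add_distrib,
        mul_assoc]

/-- Sum of `f` over all lists of words that arise from `L` by removing one letter `x` or `xᵀ` and
inserting `u` (transposed or not) in its place, up to cyclic rotation. -/
def mergeSum {M : Type*} [AddCommMonoid M] (x : Letter C) (u : List (Letter C)) :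
    List (List (Letter C)) → (List (List (Letter C)) → M) → M
  | [], _ => 0
  | w :: L, f =>
      ∑ n : Fin w.length,
        ((if w[n] = x then f ((wordAdj u ++ (w.drop (n + 1) ++ w.take n)) :: L) else 0)
        + if w[n] = x.adj then f ((w.take n ++ (u ++ w.drop (n + 1))) :: L) else 0)
      + mergeSum x u L fun L' => f (w :: L')

lemma map_mergeSum {M N G : Type*} [AddCommMonoid M] [AddCommMonoid N] [FunLike G M N]
    [AddMonoidHomClass G M N] (g : G) (x : Letter C)
    (u : List (Letter C)) (L : List (List (Letter C))) (f : List (List (Letter C)) → M) :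
    g (mergeSum x u L f) = mergeSum x u L fun L' => g (f L') := by
  induction L generalizing f with
  | nil => simp [mergeSum]
  | cons w L ih => simp [mergeSum, ih, apply_ite g]

/-- Deleting a letter opens the trace, and contracting with `u` closes it again into a single trace.
The factor `1/d` of the derivative is therefore not compensated. -/
lemma IsGaussianFamily.contract_wordTrace (h : IsGaussianFamily σ A E D)
    (x : Letter C) (u w : List (Letter C)) :
    ∑ i, ∑ j, wordMat A u j i * letterDer D x i j (wordTrace A w)
      = (d : ℝ)⁻¹ • ∑ n : Fin w.length,
        ((if w[n] = x then wordTrace A (wordAdj u ++ (w.drop (n + 1) ++ w.take n)) else 0)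
        + if w[n] = x.adj then wordTrace A (w.take n ++ (u ++ w.drop (n + 1))) else 0) := by
  have key : ∀ i j, letterDer D x i j (wordMat A w).trace = (d : ℝ)⁻¹ • ∑ n : Fin w.length,
      ((if w[n] = x then
          ∑ k, wordMat A (w.take n) k i * wordMat A (w.drop (n + 1)) j k else 0)
        + if w[n] = x.adj then
          ∑ k, wordMat A (w.take n) k j * wordMat A (w.drop (n + 1)) i k else 0) := by
    intro i j
    simp only [Matrix.trace, Matrix.diag, map_sum, h.letterDer_wordMat, ← Finset.smul_sum]
    rw [Finset.sum_comm]
    congr 1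
    refine Finset.sum_congr rfl fun n _ => ?_
    rw [Finset.sum_add_distrib]
    split_ifs <;> simp
  simp only [wordTrace, Derivation.map_smul, key, mul_smul_comm, ← Finset.smul_sum,
    Finset.mul_sum (Finset.univ : Finset (Fin w.length))]
  rw [show ∑ i, ∑ j, ∑ n : Fin w.length, wordMat A u j i *
      ((if w[n] = x then
          ∑ k, wordMat A (w.take n) k i * wordMat A (w.drop (n + 1)) j k else 0)
        + if w[n] = x.adj then
          ∑ k, wordMat A (w.take n) k j * wordMat A (w.drop (n + 1)) i k else 0)
      = ∑ n : Fin w.length, ∑ i, ∑ j, wordMat A u j i *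
      ((if w[n] = x then
          ∑ k, wordMat A (w.take n) k i * wordMat A (w.drop (n + 1)) j k else 0)
        + if w[n] = x.adj then
          ∑ k, wordMat A (w.take n) k j * wordMat A (w.drop (n + 1)) i k else 0) from by
    simp only [Finset.sum_comm (t := (Finset.univ : Finset (Fin w.length)))]]
  congr 1
  rw [Finset.smul_sum]
  refine Finset.sum_congr rfl fun n _ => ?_
  simp only [mul_add, Finset.sum_add_distrib, smul_add, wordMat_append, wordMat_wordAdj]
  congr 1
  · rw [← sum_mul_trace_transpose]
    split_ifs <;> simp
  · rw [← sum_mul_trace]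
    split_ifs <;> simp

lemma IsGaussianFamily.contract_traceProd (h : IsGaussianFamily σ A E D)
    (x : Letter C) (u : List (Letter C)) (L : List (List (Letter C))) :
    ∑ i, ∑ j, wordMat A u j i * letterDer D x i j (traceProd A L)
      = (d : ℝ)⁻¹ • mergeSum x u L (traceProd A) := by
  induction L with
  | nil => simp [traceProd, mergeSum]
  | cons w L ih =>
    have h1 : mergeSum x u L (fun L' => traceProd A (w :: L'))
        = wordTrace A w * mergeSum x u L (traceProd A) := by
      simp only [traceProd_cons]
      exact (map_mergeSum (AddMonoidHom.mulLeft (wordTrace A w)) x u L (traceProd A)).symm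
    rw [mergeSum, h1, smul_add, ← mul_smul_comm, ← ih]
    simp only [traceProd_cons, Derivation.leibniz, smul_eq_mul, mul_add, Finset.sum_add_distrib]
    rw [add_comm]
    congr 1
    · have h2 := congrArg (· * traceProd A L) (h.contract_wordTrace x u w)
      simp only [smul_mul_assoc, Finset.sum_mul, add_mul, ite_mul, zero_mul,
        Finset.sum_add_distrib] at h2
      rw [← h2]
      refine Finset.sum_congr rfl fun i _ => Finset.sum_congr rfl fun j _ => by ring
    · simp only [Finset.mul_sum]
      refine Finset.sum_congr rfl fun i _ => Finset.sum_congr rfl fun j _ => by ring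

/-- Pairing with a transposed letter closes two index loops, hence two traces and a net factor `d`;
pairing with an untransposed copy closes only one. This gap in powers of `d` is what selects planar
pairings. -/
lemma IsGaussianFamily.contract_wordMat (h : IsGaussianFamily σ A E D) (hd : d ≠ 0)
    (x : Letter C) (u : List (Letter C)) :
    ∑ i, ∑ j, letterDer D x i j (wordMat A u j i)
      = ∑ n : Fin u.length,
        ((if u[n] = x then wordTrace A (u.take n ++ wordAdj (u.drop (n + 1))) else 0)
        + if u[n] = x.adj then (d : ℝ) • (wordTrace A (u.take n) * wordTrace A (u.drop (n + 1)))
          else 0) := by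
  have hd' : (d : ℝ) ≠ 0 := by exact_mod_cast hd
  simp only [h.letterDer_wordMat, ← Finset.smul_sum]
  simp only [Finset.sum_comm (t := (Finset.univ : Finset (Fin u.length)))]
  rw [Finset.smul_sum]
  refine Finset.sum_congr rfl fun n _ => ?_
  simp only [Finset.sum_add_distrib, smul_add]
  congr 1
  · split_ifs
    · rw [wordTrace, wordMat_append, wordMat_wordAdj]
      congr 1
      simp only [Matrix.trace, Matrix.diag, Matrix.mul_apply, Matrix.transpose_apply]
      exact Finset.sum_comm
    · simp
  · split_ifs
    · have e := congrArg₂ (· * ·) (trace_wordMat A hd (u.take n))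
        (trace_wordMat A hd (u.drop (n + 1)))
      simp only [Matrix.trace, Matrix.diag, Finset.sum_mul_sum] at e
      rw [Finset.sum_comm, e, smul_mul_smul_comm, smul_smul]
      congr 1
      field_simp
    · simp

/-- The loop equation. -/
lemma IsGaussianFamily.exp_traceProd_cons (h : IsGaussianFamily σ A E D) (hd : d ≠ 0)
    (x : Letter C) (u : List (Letter C)) (L : List (List (Letter C))) :
    E (traceProd A ((x :: u) :: L)) = σ x.1 ^ 2 *
      (∑ n : Fin u.length,
        ((d : ℝ)⁻¹ *
          (if u[n] = x then E (traceProd A ((u.take n ++ wordAdj (u.drop (n + 1))) :: L)) else 0)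
        + if u[n] = x.adj then E (traceProd A (u.take n :: u.drop (n + 1) :: L)) else 0)
      + (d : ℝ)⁻¹ * ((d : ℝ)⁻¹ * mergeSum x u L fun L' => E (traceProd A L'))) := by
  have hd' : (d : ℝ) ≠ 0 := by exact_mod_cast hd
  have e1 : traceProd A ((x :: u) :: L) = (d : ℝ)⁻¹ • ∑ i, ∑ j,
      letterMat A x i j * (wordMat A u j i * traceProd A L) := by
    rw [traceProd_cons, wordTrace, wordMat_cons, smul_mul_assoc]
    simp only [Matrix.trace, Matrix.diag, Matrix.mul_apply, Finset.sum_mul, mul_assoc]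
  -- Integration by parts in the entries of the leading letter; the Leibniz rule separates pairings
  -- inside `u` from pairings with the other words.
  have e2 : E (traceProd A ((x :: u) :: L)) = σ x.1 ^ 2 * (d : ℝ)⁻¹ *
      E ((∑ i, ∑ j, letterDer D x i j (wordMat A u j i)) * traceProd A L
        + ∑ i, ∑ j, wordMat A u j i * letterDer D x i j (traceProd A L)) := by
    rw [e1]
    simp only [map_smul, map_sum, h.exp_letterMat_mul, Derivation.leibniz, map_add, smul_eq_mul,
      ← Finset.mul_sum, Finset.sum_add_distrib, Finset.sum_mul]
    rw [add_comm]
    simp only [mul_comm (traceProd A L)]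
    ring
  rw [e2, h.contract_wordMat hd, h.contract_traceProd, map_add, map_smul, smul_eq_mul,
    map_mergeSum, mul_assoc, mul_add]
  congr 2
  rw [Finset.sum_mul, map_sum, Finset.mul_sum]
  refine Finset.sum_congr rfl fun n _ => ?_
  rw [add_mul, map_add, mul_add]
  congr 1
  · split_ifs <;> simp [traceProd_cons]
  · split_ifs
    · rw [smul_mul_assoc, map_smul, smul_eq_mul, inv_mul_cancel_left₀ hd', traceProd_cons,
        traceProd_cons, mul_assoc]
    · simp

end Words

/-! ### Free moments as limits of the loop equation -/

section FreeMoments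

variable {C : Type*} [DecidableEq C]

/-- Limits of the normalized traces of words in independent Gaussian matrices with entries of
variance `σ c ^ 2 / d`: the moments of free circular variables of variances `σ c ^ 2`. -/
def freeMoment (σ : C → ℝ) : List (Letter C) → ℝ
  | [] => 1
  | x :: u => σ x.1 ^ 2 * ∑ n : Fin u.length,
      if u[n] = x.adj then freeMoment σ (u.take n) * freeMoment σ (u.drop (n + 1)) else 0
  termination_by w => w.length
  decreasing_by
  all_goals simp only [List.length_take, List.length_drop, List.length_cons]; omega

/-- The total number of letters plus the number of words. -/
def wordSize (L : List (List (Letter C))) : ℕ := (L.map List.length).sum + L.length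

omit [DecidableEq C] in
@[simp] lemma wordSize_cons (w : List (Letter C)) (L : List (List (Letter C))) :
    wordSize (w :: L) = wordSize L + w.length + 1 := by
  simp only [wordSize, List.map_cons, List.sum_cons, List.length_cons]
  omega

/-- Each merge replaces one letter by `u`, which gives the size bound needed for the strong
induction below. -/
lemma tendsto_mergeSum (x : Letter C) (u : List (Letter C)) (L : List (List (Letter C)))
    {f : ℕ → List (List (Letter C)) → ℝ} {g : List (List (Letter C)) → ℝ}
    (h : ∀ L', wordSize L' < wordSize L + u.length →
      Tendsto (fun d => f d L') atTop (𝓝 (g L'))) :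
    Tendsto (fun d => mergeSum x u L (f d)) atTop (𝓝 (mergeSum x u L g)) := by
  induction L generalizing f g with
  | nil => simp [mergeSum]
  | cons w L ih =>
    simp only [mergeSum]
    refine Tendsto.add (tendsto_finsetSum _ fun n _ => Tendsto.add ?_ ?_)
      (ih fun L' hL' => h _ ?_)
    · split_ifs
      · refine h _ ?_
        simp only [wordSize_cons, List.length_append, wordAdj_length, List.length_drop,
          List.length_take]
        omega
      · exact tendsto_const_nhds
    · split_ifs
      · refine h _ ?_
        simp only [wordSize_cons, List.length_append, List.length_drop, List.length_take]
        omega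
      · exact tendsto_const_nhds
    · simp only [wordSize_cons]
      omega

/-- Solutions of the loop equations converge to products of free moments. -/
theorem tendsto_prod_freeMoment (σ : C → ℝ) (m : ℕ → List (List (Letter C)) → ℝ)
    (h0 : ∀ d, m d [] = 1) (h1 : ∀ d, d ≠ 0 → ∀ L, m d ([] :: L) = m d L)
    (h2 : ∀ d, d ≠ 0 → ∀ (x : Letter C) (u : List (Letter C)) (L : List (List (Letter C))),
      m d ((x :: u) :: L) = σ x.1 ^ 2 *
      (∑ n : Fin u.length,
        ((d : ℝ)⁻¹ *
          (if u[n] = x then m d ((u.take n ++ wordAdj (u.drop (n + 1))) :: L) else 0)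
        + if u[n] = x.adj then m d (u.take n :: u.drop (n + 1) :: L) else 0)
      + (d : ℝ)⁻¹ * ((d : ℝ)⁻¹ * mergeSum x u L (m d))))
    (L : List (List (Letter C))) :
    Tendsto (fun d => m d L) atTop (𝓝 (L.map (freeMoment σ)).prod) := by
  -- Counting words as well as letters makes the removal of an empty word a decrease too; splitting
  -- removes two letters and adds only one word.
  induction hN : wordSize L using Nat.strong_induction_on generalizing L with
  | _ N ih =>
    have hinv : Tendsto (fun d : ℕ => (d : ℝ)⁻¹) atTop (𝓝 0) := tendsto_inv_atTop_nhds_zero_nat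
    rcases L with _ | ⟨_ | ⟨x, u⟩, L⟩
    · simp [h0]
    · have := ih (wordSize L) (by rw [← hN, wordSize_cons]; omega) L rfl
      have e : (([] :: L).map (freeMoment σ)).prod = (L.map (freeMoment σ)).prod := by
        simp [freeMoment]
      rw [e]
      refine this.congr' ?_
      filter_upwards [eventually_ne_atTop 0] with d hd
      rw [h1 d hd]
    -- The recursion for `freeMoment` is written as the loop equation with `d⁻¹` replaced by `0`, so
    -- limits can be taken term by term.
    · have e : (((x :: u) :: L).map (freeMoment σ)).prod = σ x.1 ^ 2 *
          (∑ n : Fin u.length,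
            (0 * (if u[n] = x then
                (((u.take n ++ wordAdj (u.drop (n + 1))) :: L).map (freeMoment σ)).prod else 0)
            + if u[n] = x.adj then
                ((u.take n :: u.drop (n + 1) :: L).map (freeMoment σ)).prod else 0)
          + 0 * (0 * mergeSum x u L fun L' => (L'.map (freeMoment σ)).prod)) := by
        rw [List.map_cons, List.prod_cons, freeMoment]
        simp only [zero_mul, zero_add, add_zero, mul_assoc, Finset.sum_mul, ite_mul,
          List.map_cons, List.prod_cons]
      rw [e]
      refine Tendsto.congr' (f₁ := fun d : ℕ => σ x.1 ^ 2 *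
        (∑ n : Fin u.length,
          ((d : ℝ)⁻¹ *
            (if u[n] = x then m d ((u.take n ++ wordAdj (u.drop (n + 1))) :: L) else 0)
          + if u[n] = x.adj then m d (u.take n :: u.drop (n + 1) :: L) else 0)
        + (d : ℝ)⁻¹ * ((d : ℝ)⁻¹ * mergeSum x u L (m d)))) ?_ ?_
      · filter_upwards [eventually_ne_atTop 0] with d hd
        rw [h2 d hd]
      simp only [wordSize_cons, List.length_cons] at hN
      refine Tendsto.const_mul _ (Tendsto.add (tendsto_finsetSum _ fun n _ => Tendsto.add ?_ ?_)
        (hinv.mul (hinv.mul (tendsto_mergeSum x u L fun L' hL' => ih _ ?_ L' rfl))))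
      · refine hinv.mul ?_
        split_ifs
        · refine ih _ ?_ _ rfl
          simp only [wordSize_cons, List.length_append, wordAdj_length, List.length_drop,
            List.length_take]
          omega
        · exact tendsto_const_nhds
      · split_ifs
        · refine ih _ ?_ _ rfl
          simp only [wordSize_cons, List.length_drop, List.length_take]
          omega
        · exact tendsto_const_nhds
      · omega

end FreeMoments

/-! ### Moments of bilinear forms on Gaussian vectors -/

section QuadraticForms

variable {R : Type*} [CommRing R] [Algebra ℝ R] {d : ℕ} {κ : Type*} [DecidableEq κ]

/-- The vectors `g a` have independent centred Gaussian entries of variance `s a ^ 2` under the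
expectation `E`, expressed by Gaussian integration by parts; `G a i` is the derivative in
`g a i`. -/
structure IsGaussianVectors (s : κ → ℝ) (g : κ → Fin d → R) (E : R →ₗ[ℝ] ℝ)
    (G : κ → Fin d → Derivation ℝ R R) : Prop where
  exp_mul : ∀ a i F, E (g a i * F) = s a ^ 2 * E (G a i F)
  deriv_apply : ∀ a i b j, G a i (g b j) = if b = a ∧ j = i then (1 : R) else 0

variable {s : κ → ℝ} {g : κ → Fin d → R} {E : R →ₗ[ℝ] ℝ} {G : κ → Fin d → Derivation ℝ R R}

lemma IsGaussianVectors.deriv_mulVec (h : IsGaussianVectors s g E G)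
    {N : Matrix (Fin d) (Fin d) R} (hN : ∀ a i k l, G a i (N k l) = 0) (a b : κ) (i k : Fin d) :
    G a i ((N *ᵥ g b) k) = if b = a then N k i else 0 := by
  simp only [Matrix.mulVec, dotProduct, map_sum, Derivation.leibniz, hN, h.deriv_apply,
    smul_eq_mul]
  by_cases hab : b = a <;> simp [hab]

lemma IsGaussianVectors.deriv_form (h : IsGaussianVectors s g E G)
    {N : Matrix (Fin d) (Fin d) R} (hN : ∀ a i k l, G a i (N k l) = 0) (a b c : κ) (i : Fin d) :
    G c i (g a ⬝ᵥ N *ᵥ g b) = (if a = c then (N *ᵥ g b) i else 0)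
      + if b = c then (Nᵀ *ᵥ g a) i else 0 := by
  simp only [dotProduct, map_sum, Derivation.leibniz, h.deriv_mulVec hN, h.deriv_apply,
    smul_eq_mul, Finset.sum_add_distrib]
  rw [add_comm]
  congr 1
  · by_cases hac : a = c <;> simp [hac]
  · by_cases hbc : b = c <;> simp [hbc, Matrix.mulVec, dotProduct, mul_comm]

lemma IsGaussianVectors.exp_form (h : IsGaussianVectors s g E G)
    {N : Matrix (Fin d) (Fin d) R} (hN : ∀ a i k l, G a i (N k l) = 0) (a b : κ) :
    E (g a ⬝ᵥ N *ᵥ g b) = if b = a then s a ^ 2 * E N.trace else 0 := by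
  simp only [dotProduct, map_sum, h.exp_mul, h.deriv_mulVec hN]
  by_cases hab : b = a <;> simp [hab, Matrix.trace, Finset.mul_sum]

/-- The three Wick pairings of four Gaussian vectors. `N` may be random, but by `hN` it does not
involve `g`. -/
lemma IsGaussianVectors.exp_form_sq (h : IsGaussianVectors s g E G)
    {N : Matrix (Fin d) (Fin d) R} (hN : ∀ a i k l, G a i (N k l) = 0) (a b : κ) :
    E ((g a ⬝ᵥ N *ᵥ g b) ^ 2) = s a ^ 2 * s b ^ 2 * (E (Nᵀ * N).trace
      + if b = a then E (N.trace * N.trace) + E (N * N).trace else 0) := by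
  have hT : ∀ a i k l, G a i (Nᵀ k l) = 0 := fun a i k l => hN a i l k
  have hmul : ∀ {M N : Matrix (Fin d) (Fin d) R}, (∀ a i k l, G a i (M k l) = 0) →
      (∀ a i k l, G a i (N k l) = 0) → ∀ a i k l, G a i ((M * N) k l) = 0 := by
    intro M N hM hN a i k l
    simp [Matrix.mul_apply, hM, hN]
  have htr : ∀ a i k l, G a i ((N.trace • N) k l) = 0 := by
    intro a i k l
    simp [Matrix.trace, hN]
  have e1 : E ((g a ⬝ᵥ N *ᵥ g b) ^ 2) = s a ^ 2 * E ((N *ᵥ g b) ⬝ᵥ (N *ᵥ g b)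
      + if b = a then g a ⬝ᵥ (N.trace • N) *ᵥ g b + (N *ᵥ g b) ⬝ᵥ (Nᵀ *ᵥ g a) else 0) := by
    rw [sq]
    nth_rewrite 1 [dotProduct]
    simp only [Finset.sum_mul, mul_assoc, map_sum, h.exp_mul, Derivation.leibniz,
      h.deriv_mulVec hN, h.deriv_form hN, if_true, smul_eq_mul, ← Finset.mul_sum]
    congr 1
    rw [← map_sum]
    congr 1
    by_cases hab : b = a
    · simp only [hab, if_true, mul_add, Finset.sum_add_distrib, Matrix.smul_mulVec,
        dotProduct_smul, smul_eq_mul, ← Finset.mul_sum]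
      simp only [Matrix.trace, Matrix.diag, dotProduct]
      ring
    · simp [hab, dotProduct]
  have e2 : (N *ᵥ g b) ⬝ᵥ (N *ᵥ g b) = g b ⬝ᵥ (Nᵀ * N) *ᵥ g b := by
    rw [← Matrix.mulVec_mulVec, Matrix.dotProduct_mulVec (g b), Matrix.vecMul_transpose]
  have e3 : (N *ᵥ g b) ⬝ᵥ (Nᵀ *ᵥ g a) = g a ⬝ᵥ (N * N) *ᵥ g b := by
    rw [← Matrix.mulVec_mulVec, Matrix.dotProduct_mulVec (g a), Matrix.mulVec_transpose,
      dotProduct_comm]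
  rw [e1, map_add, e2, h.exp_form (hmul hT hN)]
  by_cases hab : b = a
  · subst hab
    simp only [if_true, map_add, e3, h.exp_form (hmul hN hN), h.exp_form htr, Matrix.trace_smul,
      smul_eq_mul]
    ring
  · simp [hab]
    ring

variable {C : Type*} {A : C → Matrix (Fin d) (Fin d) R}

omit [DecidableEq κ] in
lemma deriv_wordMat_eq_zero (hA : ∀ a i c k l, G a i (A c k l) = 0) (w : List (Letter C))
    (a : κ) (i k l : Fin d) : G a i (wordMat A w k l) = 0 := by
  induction w generalizing k with
  | nil =>
    by_cases hkl : k = l <;> simp [wordMat_nil, hkl]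
  | cons x w ih =>
    obtain ⟨c, t⟩ := x
    cases t <;> simp [wordMat_cons, Matrix.mul_apply, letterMat, ih, hA]

/-- The normalized bilinear form of a word on Gaussian vectors. -/
def wordForm (A : C → Matrix (Fin d) (Fin d) R) (g : κ → Fin d → R) (a b : κ)
    (w : List (Letter C)) : R :=
  (d : ℝ)⁻¹ • (g a ⬝ᵥ wordMat A w *ᵥ g b)

lemma IsGaussianVectors.exp_wordForm (h : IsGaussianVectors s g E G)
    (hA : ∀ a i c k l, G a i (A c k l) = 0) (a b : κ) (w : List (Letter C)) :
    E (wordForm A g a b w) = if b = a then s a ^ 2 * E (traceProd A [w]) else 0 := by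
  rw [wordForm, map_smul, h.exp_form (deriv_wordMat_eq_zero hA w)]
  split_ifs
  · simp [traceProd, wordTrace]
    ring
  · simp

/-- Of the three pairings only the one producing two separate traces avoids a factor `1/d`; this is
the source of concentration. -/
lemma IsGaussianVectors.exp_wordForm_sq (h : IsGaussianVectors s g E G)
    (hA : ∀ a i c k l, G a i (A c k l) = 0) (a b : κ) (w : List (Letter C)) :
    E (wordForm A g a b w ^ 2) = s a ^ 2 * s b ^ 2 *
      ((d : ℝ)⁻¹ * E (traceProd A [wordAdj w ++ w])
      + if b = a then E (traceProd A [w, w]) + (d : ℝ)⁻¹ * E (traceProd A [w ++ w]) else 0) := by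
  rw [wordForm, smul_pow, map_smul, h.exp_form_sq (deriv_wordMat_eq_zero hA w)]
  have e : E (traceProd A [w, w])
      = (d : ℝ)⁻¹ ^ 2 * E ((wordMat A w).trace * (wordMat A w).trace) := by
    simp only [traceProd, wordTrace, List.map_cons, List.map_nil, List.prod_cons, List.prod_nil,
      mul_one, smul_mul_smul_comm, map_smul, smul_eq_mul, sq]
  rw [e]
  split_ifs <;>
  · simp only [traceProd, wordTrace, List.map_cons, List.map_nil, List.prod_cons, List.prod_nil,
      mul_one, map_smul, smul_eq_mul, wordMat_append, wordMat_wordAdj]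
    ring

end QuadraticForms

/-! ### Gradients of bilinear forms in the matrices -/

section FormDerivatives

variable {R : Type*} [CommRing R] [Algebra ℝ R] {d : ℕ} {κ C : Type*} [DecidableEq C]
  {A : C → Matrix (Fin d) (Fin d) R} {σ : C → ℝ} {E : R →ₗ[ℝ] ℝ}
  {D : C → Fin d → Fin d → Derivation ℝ R R} {g : κ → Fin d → R}

/-- Without transposed letters only the untransposed occurrences count, and each gives a rank-one
matrix in `(i, j)`. -/
lemma IsGaussianFamily.deriv_form (h : IsGaussianFamily σ A E D)
    (hg : ∀ c i j a k, D c i j (g a k) = 0) (a b : κ) {w : List (Letter C)}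
    (hw : ∀ x ∈ w, x.2 = false) (c : C) (i j : Fin d) :
    D c i j (g a ⬝ᵥ wordMat A w *ᵥ g b) = (d : ℝ)⁻¹ • ∑ n : Fin w.length,
      if w[n] = (c, false) then
        ((wordMat A (w.take n))ᵀ *ᵥ g a) i * (wordMat A (w.drop (n + 1)) *ᵥ g b) j else 0 := by
  have h1 : ∀ k l, D c i j (wordMat A w k l) = (d : ℝ)⁻¹ • ∑ n : Fin w.length,
      if w[n] = (c, false) then wordMat A (w.take n) k i * wordMat A (w.drop (n + 1)) j l
        else 0 := by
    intro k l
    have h2 := h.letterDer_wordMat (c, false) i j w k l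
    rw [show letterDer D (c, false) i j = D c i j by simp [letterDer]] at h2
    rw [h2]
    congr 1
    refine Finset.sum_congr rfl fun n _ => ?_
    have : w[n] ≠ Letter.adj (c, false) := by
      intro hn
      have := hw w[n] (List.getElem_mem _)
      rw [hn] at this
      simp [Letter.adj] at this
    rw [if_neg this, add_zero]
  simp only [dotProduct, Matrix.mulVec, map_sum, Derivation.leibniz, hg, h1, add_zero,
    zero_add, smul_eq_mul, mul_zero, mul_smul_comm, ← Finset.smul_sum, Finset.mul_sum]
  simp only [Finset.sum_comm (t := (Finset.univ : Finset (Fin w.length)))]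
  congr 1
  refine Finset.sum_congr rfl fun n _ => ?_
  split_ifs
  · rw [Finset.sum_comm]
    refine Finset.sum_congr rfl fun l _ => ?_
    rw [Finset.sum_mul]
    refine Finset.sum_congr rfl fun k _ => ?_
    rw [Matrix.transpose_apply]
    ring
  · simp

end FormDerivatives

/-! ### Network parameters as Gaussian families; the kernel as a sum of forms -/

section Parameters

variable {V : Type*} {d : ℕ}

/-- The parameters in a recurrent matrix (`c = false`) or input matrix (`c = true`). -/
def matIdx (V : Type*) (c : Bool) (i j : Fin d) : ParamIdx V d :=
  if c then Sum.inr (Sum.inr (Sum.inl (i, j))) else Sum.inr (Sum.inr (Sum.inr (i, j)))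

/-- The parameters in the output vector (`none`) or the embedding of a token. -/
def vecIdx (a : Option V) (i : Fin d) : ParamIdx V d :=
  a.elim (Sum.inl i) fun b => Sum.inr (Sum.inl (i, b))

/-- The polynomial matrices `Wʰ / √d` and `W / √d`. -/
def genMat (V : Type*) (d : ℕ) (c : Bool) :
    Matrix (Fin d) (Fin d) (MvPolynomial (ParamIdx V d) ℝ) :=
  Matrix.of fun i j => (Real.sqrt d)⁻¹ • MvPolynomial.X (matIdx V c i j)

/-- The polynomial vectors `v` and the columns of `Wᵉ`. -/
def genVec (V : Type*) (d : ℕ) (a : Option V) (i : Fin d) : MvPolynomial (ParamIdx V d) ℝ :=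
  MvPolynomial.X (vecIdx a i)

/-- Standard deviations of the matrix entries. -/
def matStd (σw σh : ℝ) (c : Bool) : ℝ := if c then σw else σh

/-- Standard deviations of the vector entries. -/
def vecStd {V : Type*} (σv σe : ℝ) (a : Option V) : ℝ := a.elim σv fun _ => σe

/-- Normalized derivatives in the matrix entries. -/
def matDer (V : Type*) (d : ℕ) (c : Bool) (i j : Fin d) :
    Derivation ℝ (MvPolynomial (ParamIdx V d) ℝ) (MvPolynomial (ParamIdx V d) ℝ) :=
  (Real.sqrt d)⁻¹ • MvPolynomial.pderiv (matIdx V c i j)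

/-- Derivatives in the vector entries. -/
def vecDer (V : Type*) (d : ℕ) (a : Option V) (i : Fin d) :
    Derivation ℝ (MvPolynomial (ParamIdx V d) ℝ) (MvPolynomial (ParamIdx V d) ℝ) :=
  MvPolynomial.pderiv (vecIdx a i)

/-- Expectation at initialization. -/
def initExp (V : Type*) [Fintype V] (σv σe σw σh : ℝ) (d : ℕ) :
    MvPolynomial (ParamIdx V d) ℝ →ₗ[ℝ] ℝ :=
  gaussExp fun p => Real.toNNReal ((initStd σv σe σw σh p) ^ 2)

lemma matIdx_inj {c c' : Bool} {i j k l : Fin d} :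
    matIdx V c i j = matIdx V c' k l ↔ c = c' ∧ i = k ∧ j = l := by
  cases c <;> cases c' <;> simp [matIdx]

lemma vecIdx_inj {a b : Option V} {i j : Fin d} :
    vecIdx a i = vecIdx b j ↔ a = b ∧ i = j := by
  cases a <;> cases b <;> simp [vecIdx, and_comm]

lemma vecIdx_ne_matIdx (a : Option V) (c : Bool) (i k l : Fin d) :
    vecIdx a i ≠ matIdx V c k l := by
  cases a <;> cases c <;> simp [vecIdx, matIdx]

lemma inv_sqrt_mul_inv_sqrt (d : ℕ) : (Real.sqrt d)⁻¹ * (Real.sqrt d)⁻¹ = (d : ℝ)⁻¹ := by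
  rw [← mul_inv, Real.mul_self_sqrt (Nat.cast_nonneg d)]

lemma vecDer_genMat (a : Option V) (i : Fin d) (c : Bool) (k l : Fin d) :
    vecDer V d a i (genMat V d c k l) = 0 := by
  simp [vecDer, genMat, MvPolynomial.pderiv_X_of_ne (vecIdx_ne_matIdx a c i k l).symm]

lemma matDer_genVec (c : Bool) (i j : Fin d) (a : Option V) (k : Fin d) :
    matDer V d c i j (genVec V d a k) = 0 := by
  simp [matDer, genVec, MvPolynomial.pderiv_X_of_ne (vecIdx_ne_matIdx a c k i j)]

variable [Fintype V]

/-- Matrices and derivations both carry `1/√d`: one factor on each side of integration by parts, two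
in the derivative of an entry. -/
lemma isGaussianFamily_genMat (σv σe σw σh : ℝ) :
    IsGaussianFamily (matStd σw σh) (genMat V d) (initExp V σv σe σw σh d) (matDer V d) where
  exp_one := gaussExp_one _
  exp_mul c i j F := by
    have hstd : initStd σv σe σw σh (matIdx V c i j) = matStd σw σh c := by
      cases c <;> rfl
    simp only [genMat, Matrix.of_apply, smul_mul_assoc, map_smul, initExp, gaussExp_X_mul, hstd,
      Real.coe_toNNReal _ (sq_nonneg _), matDer, Derivation.smul_apply, smul_eq_mul]
    ring
  deriv_apply c i j c' k l := by
    classical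
    simp only [matDer, genMat, Matrix.of_apply, Derivation.smul_apply, Derivation.map_smul,
      smul_smul, inv_sqrt_mul_inv_sqrt, MvPolynomial.pderiv_X, Pi.single_apply, matIdx_inj]

lemma isGaussianVectors_genVec [DecidableEq V] (σv σe σw σh : ℝ) :
    IsGaussianVectors (vecStd σv σe) (genVec V d) (initExp V σv σe σw σh d) (vecDer V d) where
  exp_mul a i F := by
    have hstd : initStd σv σe σw σh (vecIdx (d := d) a i) = vecStd σv σe a := by
      cases a <;> rfl
    simp only [genVec, initExp, gaussExp_X_mul, hstd, Real.coe_toNNReal _ (sq_nonneg _), vecDer]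
  deriv_apply a i b j := by
    simp only [vecDer, genVec, MvPolynomial.pderiv_X, Pi.single_apply, vecIdx_inj]

variable [DecidableEq V]

/-- The kernel `∑_p (∂P/∂θ_p) (∂Q/∂θ_p)` of polynomials. -/
def polyNTK (P Q : MvPolynomial (ParamIdx V d) ℝ) : MvPolynomial (ParamIdx V d) ℝ :=
  ∑ p, MvPolynomial.pderiv p P * MvPolynomial.pderiv p Q

omit [DecidableEq V] in
lemma polyNTK_sum {α β : Type*} (s : Finset α) (t : Finset β)
    (P : α → MvPolynomial (ParamIdx V d) ℝ) (Q : β → MvPolynomial (ParamIdx V d) ℝ) :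
    polyNTK (∑ i ∈ s, P i) (∑ j ∈ t, Q j) = ∑ i ∈ s, ∑ j ∈ t, polyNTK (P i) (Q j) := by
  simp only [polyNTK, map_sum, Finset.sum_mul_sum]
  rw [Finset.sum_comm]
  refine Finset.sum_congr rfl fun i _ => Finset.sum_comm

omit [DecidableEq V] in
lemma polyNTK_eq (P Q : MvPolynomial (ParamIdx V d) ℝ) :
    polyNTK P Q = ∑ a, ∑ i, vecDer V d a i P * vecDer V d a i Q
      + (d : ℝ) • ∑ c, ∑ i, ∑ j, matDer V d c i j P * matDer V d c i j Q := by
  by_cases hd : d = 0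
  · subst hd
    simp [polyNTK]
  have hd' : (d : ℝ) ≠ 0 := by exact_mod_cast hd
  simp only [matDer, Derivation.smul_apply, smul_mul_smul_comm, inv_sqrt_mul_inv_sqrt,
    ← Finset.smul_sum, smul_smul, mul_inv_cancel₀ hd', one_smul]
  simp only [polyNTK, Fintype.sum_sum_type, Fintype.sum_prod_type, Fintype.sum_option,
    Fintype.sum_bool, vecDer, vecIdx, matIdx, Option.elim, if_true, Bool.false_eq_true, if_false]
  rw [Finset.sum_comm (s := (Finset.univ : Finset (Fin d))) (t := (Finset.univ : Finset V))]
  ring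

/-- The polynomial `(1/√d) vᵀ w u` for a word `w` and the embedding `u` of a token. -/
def wordPoly (d : ℕ) (a : V) (w : List (Letter Bool)) : MvPolynomial (ParamIdx V d) ℝ :=
  (Real.sqrt d)⁻¹ • (genVec V d none ⬝ᵥ wordMat (genMat V d) w *ᵥ genVec V d (some a))

omit [Fintype V] [DecidableEq V] in
lemma form_transpose_mul {R : Type*} [CommRing R] (M N : Matrix (Fin d) (Fin d) R)
    (u v : Fin d → R) : u ⬝ᵥ (Mᵀ * N) *ᵥ v = ∑ i, (M *ᵥ u) i * (N *ᵥ v) i := by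
  rw [← Matrix.mulVec_mulVec, Matrix.dotProduct_mulVec, Matrix.vecMul_transpose]
  rfl

omit [Fintype V] [DecidableEq V] in
-- The Frobenius product of two rank-one matrices is a product of two inner products; gradients in
-- different matrices are orthogonal.
lemma sum_matched_products {R α β C : Type*} [CommRing R] [Fintype α] [Fintype β] [Fintype C]
    [DecidableEq C] (f : α → Letter C) (f' : β → Letter C) (hf : ∀ n, (f n).2 = false)
    (hf' : ∀ m, (f' m).2 = false) (P Q : α → Fin d → R) (P' Q' : β → Fin d → R) :
    ∑ c, ∑ i, ∑ j, (∑ n, if f n = (c, false) then P n i * Q n j else 0)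
        * (∑ m, if f' m = (c, false) then P' m i * Q' m j else 0)
      = ∑ n, ∑ m, if f n = f' m then (∑ i, P n i * P' m i) * (∑ j, Q n j * Q' m j) else 0 := by
  simp only [Finset.sum_mul_sum]
  simp only [Finset.sum_comm (t := (Finset.univ : Finset α))]
  refine Finset.sum_congr rfl fun n _ => ?_
  simp only [Finset.sum_comm (t := (Finset.univ : Finset β))]
  refine Finset.sum_congr rfl fun m _ => ?_
  obtain ⟨c, hc⟩ : ∃ c, f n = (c, false) := ⟨(f n).1, by rw [← hf n]⟩
  obtain ⟨c', hc'⟩ : ∃ c', f' m = (c', false) := ⟨(f' m).1, by rw [← hf' m]⟩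
  simp only [hc, hc', Prod.mk.injEq, and_true]
  rw [Finset.sum_eq_single c]
  · by_cases h : c = c'
    · simp only [h, if_true]
      refine Finset.sum_congr rfl fun i _ => Finset.sum_congr rfl fun j _ => by ring
    · simp [h, Ne.symm h]
  · intro b _ hb
    simp [hb.symm]
  · simp

/-- The three groups are the gradients in `v`, in `Wᵉ` (different tokens use disjoint columns) and
in the matrices. -/
lemma polyNTK_wordPoly (a b : V) {w w' : List (Letter Bool)} (hw : ∀ x ∈ w, x.2 = false)
    (hw' : ∀ x ∈ w', x.2 = false) :
    polyNTK (wordPoly d a w) (wordPoly d b w')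
      = wordForm (genMat V d) (genVec V d) (some a) (some b) (wordAdj w ++ w')
      + (if a = b then wordForm (genMat V d) (genVec V d) none none (w ++ wordAdj w') else 0)
      + ∑ n : Fin w.length, ∑ m : Fin w'.length, if w[n] = w'[m] then
          wordForm (genMat V d) (genVec V d) none none (w.take n ++ wordAdj (w'.take m))
          * wordForm (genMat V d) (genVec V d) (some a) (some b)
            (wordAdj (w.drop (n + 1)) ++ w'.drop (m + 1)) else 0 := by
  -- Only derivative identities are used here, so the variances are arbitrary.
  have hfam := isGaussianFamily_genMat (V := V) (d := d) 1 1 1 1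
  have hvec := isGaussianVectors_genVec (V := V) (d := d) 1 1 1 1
  have hN := fun w => deriv_wordMat_eq_zero (G := vecDer V d) (A := genMat V d) vecDer_genMat w
  rw [polyNTK_eq]
  simp only [wordPoly, Derivation.map_smul, smul_mul_smul_comm, inv_sqrt_mul_inv_sqrt,
    ← Finset.smul_sum, hvec.deriv_form (hN _), hfam.deriv_form matDer_genVec _ _ hw,
    hfam.deriv_form matDer_genVec _ _ hw', Fintype.sum_option]
  have hmatch := sum_matched_products (d := d) (fun n : Fin w.length => w[n])
    (fun m : Fin w'.length => w'[m])
    (fun n => hw _ (List.getElem_mem _)) (fun n => hw' _ (List.getElem_mem _))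
    (fun n => (wordMat (genMat V d) (w.take n))ᵀ *ᵥ genVec V d none)
    (fun n => wordMat (genMat V d) (w.drop (n + 1)) *ᵥ genVec V d (some a))
    (fun m => (wordMat (genMat V d) (w'.take m))ᵀ *ᵥ genVec V d none)
    (fun m => wordMat (genMat V d) (w'.drop (m + 1)) *ᵥ genVec V d (some b))
  rw [hmatch]
  -- The factor `d` of `polyNTK_eq` cancels the two `1/√d` of `wordPoly`; the two `1/d` of the
  -- matrix derivatives normalize the two forms.
  have hscal : (d : ℝ) * (d : ℝ)⁻¹ * ((d : ℝ)⁻¹ * (d : ℝ)⁻¹) = (d : ℝ)⁻¹ * (d : ℝ)⁻¹ := by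
    by_cases hd : (d : ℝ) = 0
    · simp [hd]
    · field_simp
  rw [smul_smul, smul_smul, hscal, smul_add]
  simp only [wordForm, wordMat_append, wordMat_wordAdj, form_transpose_mul, smul_mul_smul_comm]
  refine congrArg₂ (· + ·) ?_ ?_
  · refine congrArg₂ (· + ·) ?_ ?_
    · simp
    · have e := form_transpose_mul (wordMat (genMat V d) w)ᵀ (wordMat (genMat V d) w')ᵀ
        (genVec V d none) (genVec V d none)
      rw [Matrix.transpose_transpose] at e
      rw [e]
      by_cases hab : a = b
      · simp [hab]
      · simp [hab]
  · rw [Finset.smul_sum]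
    refine Finset.sum_congr rfl fun n _ => ?_
    rw [Finset.smul_sum]
    refine Finset.sum_congr rfl fun m _ => ?_
    have e := form_transpose_mul (wordMat (genMat V d) (w.take n))ᵀ
      (wordMat (genMat V d) (w'.take m))ᵀ (genVec V d none) (genVec V d none)
    rw [Matrix.transpose_transpose] at e
    rw [e]
    split_ifs <;> simp

end Parameters

/-! ### Limits of the bilinear forms -/

section FormLimits

variable {V : Type*} [Fintype V] [DecidableEq V]

instance isProbabilityMeasure_initLaw (σv σe σw σh : ℝ) (d : ℕ) :
    IsProbabilityMeasure (initLaw V σv σe σw σh d) := by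
  unfold initLaw
  infer_instance

omit [DecidableEq V] in
lemma initExp_eq (σv σe σw σh : ℝ) (d : ℕ) (P : MvPolynomial (ParamIdx V d) ℝ) :
    ∫ θ, MvPolynomial.eval θ P ∂initLaw V σv σe σw σh d = initExp V σv σe σw σh d P := rfl

omit [DecidableEq V] in
lemma tendsto_initExp_traceProd (σv σe σw σh : ℝ) (L : List (List (Letter Bool))) :
    Tendsto (fun d => initExp V σv σe σw σh d (traceProd (genMat V d) L)) atTop
      (𝓝 (L.map (freeMoment (matStd σw σh))).prod) := by
  refine tendsto_prod_freeMoment (matStd σw σh)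
    (fun d L => initExp V σv σe σw σh d (traceProd (genMat V d) L)) ?_ ?_ ?_ L
  · intro d
    simpa [traceProd] using (isGaussianFamily_genMat (V := V) (d := d) σv σe σw σh).exp_one
  · intro d hd L
    simp only [traceProd_cons, wordTrace_nil _ hd, one_mul]
  · intro d hd x u L
    exact (isGaussianFamily_genMat (V := V) σv σe σw σh).exp_traceProd_cons hd x u L

lemma convergesInProb_wordForm (σv σe σw σh : ℝ) (a b : Option V) (w : List (Letter Bool)) :
    ConvergesInProb (initLaw V σv σe σw σh)
      (fun d θ => MvPolynomial.eval θ (wordForm (genMat V d) (genVec V d) a b w))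
      (if a = b then vecStd σv σe a ^ 2 * freeMoment (matStd σw σh) w else 0) := by
  have hinv : Tendsto (fun d : ℕ => (d : ℝ)⁻¹) atTop (𝓝 0) := tendsto_inv_atTop_nhds_zero_nat
  have hv := fun d => isGaussianVectors_genVec (V := V) (d := d) σv σe σw σh
  have hT := tendsto_initExp_traceProd (V := V) σv σe σw σh
  refine convergesInProb_of_moments (fun d => integrable_eval_pi_gaussianReal _ _) (fun d => ?_)
    ?_ ?_
  · simp only [← map_pow]
    exact integrable_eval_pi_gaussianReal _ _
  · simp only [initExp_eq, (hv _).exp_wordForm vecDer_genMat, eq_comm (a := b)]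
    split_ifs
    · simpa using (hT [w]).const_mul (vecStd σv σe a ^ 2)
    · exact tendsto_const_nhds
  · simp only [← map_pow, initExp_eq, (hv _).exp_wordForm_sq vecDer_genMat, eq_comm (a := b)]
    split_ifs with hab
    · subst hab
      have h := ((hinv.mul (hT [wordAdj w ++ w])).add ((hT [w, w]).add
        (hinv.mul (hT [w ++ w])))).const_mul (vecStd σv σe a ^ 2 * vecStd σv σe a ^ 2)
      convert h using 2
      simp
      ring
    · have h := ((hinv.mul (hT [wordAdj w ++ w])).add
        (tendsto_const_nhds (x := (0 : ℝ)))).const_mul (vecStd σv σe a ^ 2 * vecStd σv σe b ^ 2)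
      convert h using 2
      simp

end FormLimits

/-! ### Free moments of the words that occur -/

section SignedWords

variable {C : Type*} [DecidableEq C]

omit [DecidableEq C] in
lemma Letter.adj_injective : Function.Injective (Letter.adj : Letter C → Letter C) :=
  Function.LeftInverse.injective Letter.adj_adj

omit [DecidableEq C] in
lemma wordAdj_wordAdj (w : List (Letter C)) : wordAdj (wordAdj w) = w := by
  have : (Letter.adj : Letter C → Letter C) ∘ Letter.adj = id := funext Letter.adj_adj
  simp [wordAdj, this]

omit [DecidableEq C] in
lemma snd_of_mem_wordAdj {w : List (Letter C)} {t : Bool} (hw : ∀ x ∈ w, x.2 = t) :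
    ∀ x ∈ wordAdj w, x.2 = !t := by
  intro x hx
  simp only [wordAdj, List.mem_reverse, List.mem_map] at hx
  obtain ⟨y, hy, rfl⟩ := hx
  simp [Letter.adj, hw y hy]

/-- The product of the variances of the letters of a word. -/
def wordVar (σ : C → ℝ) (w : List (Letter C)) : ℝ := (w.map fun x => σ x.1 ^ 2).prod

omit [DecidableEq C] in
lemma wordVar_wordAdj (σ : C → ℝ) (w : List (Letter C)) : wordVar σ (wordAdj w) = wordVar σ w := by
  simp only [wordVar, wordAdj, List.map_reverse, List.map_map, List.prod_reverse]
  rfl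

/-- The first letter needs a partner of the opposite transposition, and there is none. -/
lemma freeMoment_eq_zero (σ : C → ℝ) {w : List (Letter C)} {t : Bool} (hw : ∀ x ∈ w, x.2 = t)
    (hne : w ≠ []) : freeMoment σ w = 0 := by
  obtain _ | ⟨x, u⟩ := w
  · exact absurd rfl hne
  rw [freeMoment, Finset.sum_eq_zero, mul_zero]
  intro n _
  rw [if_neg]
  intro h
  have h1 := hw u[n] (List.mem_cons_of_mem _ (List.getElem_mem _))
  have h2 := hw x List.mem_cons_self
  rw [h] at h1
  simp [Letter.adj, h2] at h1

/-- The first letter must pair with the last: a partner in `w` has the wrong transposition, and an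
earlier one in `wordAdj w'` leaves a nonempty suffix of equally transposed letters, whose moment is
zero. Peeling off this outer pair gives the induction. -/
lemma freeMoment_append_wordAdj (σ : C → ℝ) {w w' : List (Letter C)} {t : Bool}
    (hw : ∀ x ∈ w, x.2 = t) (hw' : ∀ x ∈ w', x.2 = t) :
    freeMoment σ (w ++ wordAdj w') = if w = w' then wordVar σ w else 0 := by
  induction w generalizing w' with
  | nil =>
    by_cases h : [] = w'
    · subst h
      simp [freeMoment, wordAdj, wordVar]
    · rw [if_neg h, List.nil_append]
      refine freeMoment_eq_zero σ (snd_of_mem_wordAdj hw') ?_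
      intro h0
      apply h
      rw [← wordAdj_wordAdj w', h0]
      rfl
  | cons x u ih =>
    obtain _ | ⟨y, u'⟩ := w'
    · rw [if_neg (by simp)]
      refine freeMoment_eq_zero σ (t := t) ?_ (by simp)
      simpa [wordAdj] using hw
    have hx := hw x List.mem_cons_self
    have hu : ∀ z ∈ u, z.2 = t := fun z hz => hw z (List.mem_cons_of_mem _ hz)
    have hu' : ∀ z ∈ u', z.2 = t := fun z hz => hw' z (List.mem_cons_of_mem _ hz)
    have e : x :: u ++ wordAdj (y :: u') = x :: ((u ++ wordAdj u') ++ [y.adj]) := by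
      simp [wordAdj]
    rw [e, freeMoment]
    have hlen : (u ++ wordAdj u').length < ((u ++ wordAdj u') ++ [y.adj]).length := by simp
    rw [Finset.sum_eq_single ⟨(u ++ wordAdj u').length, hlen⟩]
    · simp only [Fin.getElem_fin, List.getElem_concat_length, List.take_left]
      rw [List.drop_eq_nil_of_le (by rw [List.length_append, List.length_singleton]), ih hu hu']
      simp only [freeMoment, mul_one, Letter.adj_injective.eq_iff, List.cons.injEq,
        eq_comm (a := y)]
      by_cases h1 : x = y <;> by_cases h2 : u = u' <;> simp [h1, h2, wordVar]
    · rintro ⟨n, hlt⟩ _ hn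
      have hn' : n < (u ++ wordAdj u').length := by
        have h2 : n ≠ (u ++ wordAdj u').length := fun h => hn (Fin.ext h)
        rw [List.length_append, List.length_singleton] at hlt
        omega
      split_ifs with h
      swap
      · rfl
      have hun : u.length ≤ n := by
        by_contra hcon
        push Not at hcon
        have h3 : u[n] = x.adj := by
          rw [← h]
          simp [List.getElem_append_left, hcon]
        have h4 := hu _ (List.getElem_mem hcon)
        rw [h3] at h4
        simp [Letter.adj, hx] at h4
      rw [freeMoment_eq_zero σ (t := !t) (w := List.drop _ _), mul_zero]
      · intro z hz
        simp only [List.append_assoc] at hz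
        rw [List.drop_append, List.drop_eq_nil_of_le (by omega), List.nil_append] at hz
        have hz' := List.mem_of_mem_drop hz
        rw [show wordAdj u' ++ [y.adj] = wordAdj (y :: u') by simp [wordAdj]] at hz'
        exact snd_of_mem_wordAdj hw' z hz'
      · intro h0
        have h1 := congrArg List.length h0
        simp only [List.length_drop, List.length_append, List.length_singleton,
          List.length_nil] at h1 hn'
        omega
    · simp

lemma freeMoment_wordAdj_append (σ : C → ℝ) {w w' : List (Letter C)} {t : Bool}
    (hw : ∀ x ∈ w, x.2 = t) (hw' : ∀ x ∈ w', x.2 = t) :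
    freeMoment σ (wordAdj w ++ w') = if w = w' then wordVar σ w else 0 := by
  have h := freeMoment_append_wordAdj σ (snd_of_mem_wordAdj hw) (snd_of_mem_wordAdj hw')
  rw [wordAdj_wordAdj, wordVar_wordAdj] at h
  rw [h]
  have : wordAdj w = wordAdj w' ↔ w = w' :=
    ⟨fun h => by rw [← wordAdj_wordAdj w, h, wordAdj_wordAdj], fun h => by rw [h]⟩
  simp only [this]

end SignedWords

/-! ### Scores as polynomials -/

section Scores

variable {V : Type*} {d : ℕ}

/-- The word of `(Wʰ)^k W`. -/
def tokenWord (k : ℕ) : List (Letter Bool) := List.replicate k (false, false) ++ [(true, false)]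

lemma tokenWord_zero : tokenWord 0 = [(true, false)] := rfl

lemma tokenWord_succ (k : ℕ) : tokenWord (k + 1) = (false, false) :: tokenWord k := by
  simp [tokenWord, List.replicate_succ]

lemma snd_of_mem_tokenWord (k : ℕ) : ∀ x ∈ tokenWord k, x.2 = false := by
  intro x hx
  simp only [tokenWord, List.mem_append, List.mem_replicate, List.mem_singleton] at hx
  rcases hx with ⟨_, rfl⟩ | rfl <;> rfl

lemma tokenWord_inj {k l : ℕ} : tokenWord k = tokenWord l ↔ k = l := by
  refine ⟨fun h => ?_, fun h => by rw [h]⟩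
  simpa [tokenWord] using congrArg List.length h

lemma wordMat_tokenWord {R : Type*} [CommRing R] (A : Bool → Matrix (Fin d) (Fin d) R) (k : ℕ) :
    wordMat A (tokenWord k) = A false ^ k * A true := by
  induction k with
  | zero => simp [tokenWord_zero, wordMat, letterMat]
  | succ k ih =>
    rw [tokenWord_succ, wordMat_cons, ih, pow_succ', Matrix.mul_assoc]
    rfl

variable [Fintype V] [DecidableEq V]

/-- The prefactor `1/d` is split: one `1/√d` rescales `W`, the other is that of `wordPoly`. -/
lemma tokenScore_eq_eval (a : V) (k : ℕ) (θ : Params V d) :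
    tokenScore a k θ = MvPolynomial.eval θ (wordPoly d a (tokenWord k)) := by
  have hH : (genMat V d false).map (MvPolynomial.eval θ) = (1 / Real.sqrt d) • recMat θ := by
    ext i j
    simp [genMat, recMat, matIdx]
  have hW : (genMat V d true).map (MvPolynomial.eval θ) = (Real.sqrt d)⁻¹ • inMat θ := by
    ext i j
    simp [genMat, inMat, matIdx]
  have hv : MvPolynomial.eval θ ∘ genVec V d none = outVec θ := by
    ext i
    simp [genVec, outVec, vecIdx]
  have hu : MvPolynomial.eval θ ∘ genVec V d (some a) = embMat θ *ᵥ oneHot a := by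
    ext i
    simp [genVec, embMat, vecIdx, oneHot]
  have hmul : MvPolynomial.eval θ ∘ (wordMat (genMat V d) (tokenWord k) *ᵥ genVec V d (some a))
      = (wordMat (genMat V d) (tokenWord k)).map (MvPolynomial.eval θ)
        *ᵥ (MvPolynomial.eval θ ∘ genVec V d (some a)) := by
    ext i
    exact RingHom.map_mulVec (MvPolynomial.eval θ) _ _ i
  rw [wordPoly, MvPolynomial.smul_eval, RingHom.map_dotProduct, hmul, map_wordMat,
    wordMat_tokenWord, hH, hW, hv, hu, tokenScore, one_div, ← inv_sqrt_mul_inv_sqrt]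
  simp only [Matrix.mul_smul, Matrix.smul_mulVec, dotProduct_smul, smul_eq_mul,
    ← Matrix.mulVec_mulVec]
  ring

lemma hidden_eq_sum (θ : Params V d) {T : ℕ} (x : Fin T → V) :
    hidden θ x = ∑ k : Fin T, (1 / (d : ℝ)) •
      ((((1 / Real.sqrt d) • recMat θ) ^ (k : ℕ))
        *ᵥ (inMat θ *ᵥ (embMat θ *ᵥ oneHot (x k.rev)))) := by
  induction T with
  | zero => simp [hidden]
  | succ T ih =>
    -- Terms are indexed by distance from the end: the newest token is `k = 0`, and one recurrent
    -- step shifts all others by one.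
    rw [hidden, ih, Fin.sum_univ_succ, add_comm]
    congr 1
    · simp
    · rw [← Matrix.smul_mulVec, Matrix.mulVec_sum]
      refine Finset.sum_congr rfl fun k _ => ?_
      rw [Matrix.mulVec_smul, Matrix.mulVec_mulVec, Fin.val_succ, pow_succ', Fin.rev_succ]

/-- The score polynomial of an instance. -/
def scorePoly (d : ℕ) {T : ℕ} (x : Fin T → V) : MvPolynomial (ParamIdx V d) ℝ :=
  ∑ k : Fin T, wordPoly d (x k.rev) (tokenWord k)

lemma score_eq_eval {T : ℕ} (x : Fin T → V) (θ : Params V d) :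
    score x θ = MvPolynomial.eval θ (scorePoly d x) := by
  simp only [scorePoly, map_sum, ← tokenScore_eq_eval]
  rw [score, hidden_eq_sum, dotProduct_sum]
  simp only [dotProduct_smul, smul_eq_mul, tokenScore]

end Scores

/-! ### Limits of the kernels -/

section KernelLimits

variable {V : Type*} [Fintype V] [DecidableEq V]

/-- Sum over the letters of a word of the variance of the word with this letter removed. -/
def deletedVar {C : Type*} (σ : C → ℝ) (w : List (Letter C)) : ℝ :=
  ∑ n : Fin w.length, wordVar σ (w.take n) * wordVar σ (w.drop (n + 1))

lemma deletedVar_cons {C : Type*} (σ : C → ℝ) (x : Letter C) (w : List (Letter C)) :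
    deletedVar σ (x :: w) = wordVar σ w + σ x.1 ^ 2 * deletedVar σ w := by
  simp only [deletedVar, List.length_cons]
  rw [Fin.sum_univ_succ]
  simp [wordVar, Finset.mul_sum, mul_assoc]

lemma wordVar_tokenWord (σw σh : ℝ) (k : ℕ) :
    wordVar (matStd σw σh) (tokenWord k) = σh ^ (2 * k) * σw ^ 2 := by
  simp [wordVar, tokenWord, matStd, pow_mul]

/-- Deleting one of the `k` recurrent letters gives the first term, deleting the input letter the
second. -/
lemma deletedVar_tokenWord (σw σh : ℝ) (k : ℕ) :
    deletedVar (matStd σw σh) (tokenWord k)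
      = k * σh ^ (2 * k - 2) * σw ^ 2 + σh ^ (2 * k) := by
  induction k with
  | zero =>
    rw [tokenWord_zero, deletedVar_cons]
    simp [deletedVar, wordVar]
  | succ k ih =>
    rw [tokenWord_succ, deletedVar_cons, ih, wordVar_tokenWord]
    -- In the induction hypothesis `2 * k - 2` truncates at `k = 0`, so that case is separate.
    obtain _ | k := k
    · simp [matStd]
    · have e1 : 2 * (k + 1 + 1) - 2 = 2 * k + 2 := by omega
      have e2 : 2 * (k + 1) - 2 = 2 * k := by omega
      rw [e1, e2]
      simp only [matStd, Bool.false_eq_true, if_false]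
      push_cast
      ring

/-- Prefix, letter and suffix determine both the word and the cut, so only `n = m` in equal words
survives. -/
lemma sum_matched_splits {C : Type*} [DecidableEq C] (σ : C → ℝ) (w w' : List (Letter C)) :
    (∑ n : Fin w.length, ∑ m : Fin w'.length, if w[n] = w'[m] then
      (if w.take n = w'.take m then wordVar σ (w.take n) else 0)
      * (if w.drop (n + 1) = w'.drop (m + 1) then wordVar σ (w.drop (n + 1)) else 0) else 0)
      = if w = w' then deletedVar σ w else 0 := by
  by_cases hww : w = w'
  · subst hww
    rw [if_pos rfl, deletedVar]
    refine Finset.sum_congr rfl fun n _ => ?_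
    rw [Finset.sum_eq_single n]
    · simp
    · intro m _ hm
      have : w.take n ≠ w.take m := by
        intro h
        have := congrArg List.length h
        simp only [List.length_take] at this
        exact hm (Fin.ext (by omega))
      simp [this]
    · simp
  · rw [if_neg hww]
    refine Finset.sum_eq_zero fun n _ => Finset.sum_eq_zero fun m _ => ?_
    by_contra hcon
    apply hww
    have h1 : w[n] = w'[m] := by
      by_contra h
      exact hcon (if_neg h)
    have h2 : w.take n = w'.take m := by
      by_contra h; simp [h] at hcon
    have h3 : w.drop (n + 1) = w'.drop (m + 1) := by
      by_contra h; simp [h] at hcon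
    rw [← List.take_append_drop n w, ← List.take_append_drop m w', List.drop_eq_getElem_cons n.2,
      List.drop_eq_getElem_cons m.2, h2, h3]
    simp only [Fin.getElem_fin] at h1
    rw [h1]

lemma convergesInProb_polyNTK_wordPoly (σv σe σw σh : ℝ) (a b : V) {w w' : List (Letter Bool)}
    (hw : ∀ x ∈ w, x.2 = false) (hw' : ∀ x ∈ w', x.2 = false) :
    ConvergesInProb (initLaw V σv σe σw σh)
      (fun d θ => MvPolynomial.eval θ (polyNTK (wordPoly d a w) (wordPoly d b w')))
      (if a = b ∧ w = w' then (σe ^ 2 + σv ^ 2) * wordVar (matStd σw σh) w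
        + σv ^ 2 * σe ^ 2 * deletedVar (matStd σw σh) w else 0) := by
  have hform := convergesInProb_wordForm (V := V) σv σe σw σh
  have htake : ∀ n, ∀ x ∈ w.take n, x.2 = false := fun n x hx => hw x (List.mem_of_mem_take hx)
  have htake' : ∀ n, ∀ x ∈ w'.take n, x.2 = false :=
    fun n x hx => hw' x (List.mem_of_mem_take hx)
  have hdrop : ∀ n, ∀ x ∈ w.drop n, x.2 = false := fun n x hx => hw x (List.mem_of_mem_drop hx)
  have hdrop' : ∀ n, ∀ x ∈ w'.drop n, x.2 = false :=
    fun n x hx => hw' x (List.mem_of_mem_drop hx)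
  have h1 := hform (some a) (some b) (wordAdj w ++ w')
  have h2 : ConvergesInProb (initLaw V σv σe σw σh) (fun d θ => if a = b then MvPolynomial.eval θ
      (wordForm (genMat V d) (genVec V d) none none (w ++ wordAdj w')) else 0)
      (if a = b then σv ^ 2 * freeMoment (matStd σw σh) (w ++ wordAdj w') else 0) := by
    split_ifs
    · simpa [vecStd] using hform none none (w ++ wordAdj w')
    · exact convergesInProb_const 0
  have h3 : ConvergesInProb (initLaw V σv σe σw σh) (fun d θ => ∑ n : Fin w.length,
      ∑ m : Fin w'.length, if w[n] = w'[m] then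
        MvPolynomial.eval θ (wordForm (genMat V d) (genVec V d) none none
          (w.take n ++ wordAdj (w'.take m)))
        * MvPolynomial.eval θ (wordForm (genMat V d) (genVec V d) (some a) (some b)
            (wordAdj (w.drop (n + 1)) ++ w'.drop (m + 1))) else 0)
      (∑ n : Fin w.length, ∑ m : Fin w'.length, if w[n] = w'[m] then
        (σv ^ 2 * freeMoment (matStd σw σh) (w.take n ++ wordAdj (w'.take m)))
        * (if a = b then σe ^ 2 * freeMoment (matStd σw σh)
            (wordAdj (w.drop (n + 1)) ++ w'.drop (m + 1)) else 0) else 0) := by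
    refine convergesInProb_sum _ fun n _ => convergesInProb_sum _ fun m _ => ?_
    split_ifs with hnm hab
    · have := (hform none none (w.take n ++ wordAdj (w'.take m))).mul (hform (some a) (some b)
        (wordAdj (w.drop (n + 1)) ++ w'.drop (m + 1)))
      simpa only [hab, if_true, vecStd, Option.elim] using this
    · have := (hform none none (w.take n ++ wordAdj (w'.take m))).mul (hform (some a) (some b)
        (wordAdj (w.drop (n + 1)) ++ w'.drop (m + 1)))
      simpa only [hab, if_true, vecStd, Option.elim, Option.some.injEq, if_false] using this
    · exact convergesInProb_const 0
  have hsum := (h1.add h2).add h3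
  have elim : (if some a = some b then
        vecStd σv σe (some a) ^ 2 * freeMoment (matStd σw σh) (wordAdj w ++ w') else 0)
      + (if a = b then σv ^ 2 * freeMoment (matStd σw σh) (w ++ wordAdj w') else 0)
      + (∑ n : Fin w.length, ∑ m : Fin w'.length, if w[n] = w'[m] then
        (σv ^ 2 * freeMoment (matStd σw σh) (w.take n ++ wordAdj (w'.take m)))
        * (if a = b then σe ^ 2 * freeMoment (matStd σw σh)
            (wordAdj (w.drop (n + 1)) ++ w'.drop (m + 1)) else 0) else 0)
      = if a = b ∧ w = w' then (σe ^ 2 + σv ^ 2) * wordVar (matStd σw σh) w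
        + σv ^ 2 * σe ^ 2 * deletedVar (matStd σw σh) w else 0 := by
    by_cases hab : a = b
    · have e3 := congrArg (σv ^ 2 * σe ^ 2 * ·) (sum_matched_splits (matStd σw σh) w w')
      simp only [Finset.mul_sum, mul_ite, mul_zero] at e3
      simp only [hab, if_true, true_and, vecStd, Option.elim,
        freeMoment_append_wordAdj _ hw hw', freeMoment_wordAdj_append _ hw hw',
        freeMoment_append_wordAdj _ (htake _) (htake' _),
        freeMoment_wordAdj_append _ (hdrop _) (hdrop' _)]
      have e4 : (∑ n : Fin w.length, ∑ m : Fin w'.length, if w[n] = w'[m] then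
          (σv ^ 2 * if w.take n = w'.take m then wordVar (matStd σw σh) (w.take n) else 0)
          * (σe ^ 2 * if w.drop (n + 1) = w'.drop (m + 1) then
              wordVar (matStd σw σh) (w.drop (n + 1)) else 0) else 0)
          = if w = w' then σv ^ 2 * σe ^ 2 * deletedVar (matStd σw σh) w else 0 := by
        rw [← e3]
        refine Finset.sum_congr rfl fun n _ => Finset.sum_congr rfl fun m _ => ?_
        split_ifs <;> ring
      rw [e4]
      split_ifs <;> ring
    · simp [hab]
  rw [← elim]
  refine hsum.congr (Eventually.of_forall fun d θ => ?_)
  rw [polyNTK_wordPoly a b hw hw']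
  simp only [map_add, map_sum, apply_ite (MvPolynomial.eval θ), map_mul, map_zero]

lemma convergesInProb_polyNTK_tokenWord (σv σe σw σh : ℝ) (a b : V) (k l : ℕ) :
    ConvergesInProb (initLaw V σv σe σw σh)
      (fun d θ => MvPolynomial.eval θ
        (polyNTK (wordPoly d a (tokenWord k)) (wordPoly d b (tokenWord l))))
      (if k = l then rho σv σe σw σh k * (oneHot a ⬝ᵥ oneHot b) else 0) := by
  have h := convergesInProb_polyNTK_wordPoly σv σe σw σh a b (snd_of_mem_tokenWord k)
    (snd_of_mem_tokenWord l)
  convert h using 1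
  rw [wordVar_tokenWord, deletedVar_tokenWord]
  by_cases hab : a = b
  · subst hab
    by_cases hkl : k = l
    · simp only [hkl, oneHot, rho, if_true, and_self, single_dotProduct, Pi.single_eq_same]
      ring
    · simp [hkl, tokenWord_inj]
  · simp [hab, oneHot]

omit [Fintype V] in
lemma oneHotFromEnd_val {T : ℕ} (x : Fin T → V) (k : Fin T) :
    oneHotFromEnd x k = oneHot (x k.rev) := by
  rw [oneHotFromEnd, dif_pos k.2]
  congr 2
  ext
  simp only [Fin.val_rev]
  omega

omit [Fintype V] in
lemma oneHotFromEnd_of_le {T : ℕ} (x : Fin T → V) {k : ℕ} (hk : T ≤ k) :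
    oneHotFromEnd x k = 0 := by
  rw [oneHotFromEnd, dif_neg (by omega)]

lemma sum_rho_token (σv σe σw σh : ℝ) (u : V → ℝ) (k : ℕ) {T : ℕ} (x : Fin T → V) :
    (∑ l : Fin T, if k = l then rho σv σe σw σh k * (u ⬝ᵥ oneHot (x l.rev)) else 0)
      = rho σv σe σw σh k * (u ⬝ᵥ oneHotFromEnd x k) := by
  simp only [← oneHotFromEnd_val]
  rw [Fin.sum_univ_eq_sum_range (fun l => if k = l then
    rho σv σe σw σh k * (u ⬝ᵥ oneHotFromEnd x l) else 0) T, Finset.sum_ite_eq]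
  split_ifs with h
  · rfl
  · rw [oneHotFromEnd_of_le x (by simpa using h)]
    simp

lemma ntk_tokenScore_score {d : ℕ} (e : V) (k : ℕ) {T : ℕ} (x : Fin T → V) (θ : Params V d) :
    ntk (tokenScore (d := d) e k) (score (d := d) x) θ = ∑ l : Fin T,
      MvPolynomial.eval θ
        (polyNTK (wordPoly d e (tokenWord k)) (wordPoly d (x l.rev) (tokenWord l))) := by
  have h1 : tokenScore (d := d) e k
      = fun θ => MvPolynomial.eval θ (wordPoly d e (tokenWord k)) :=
    funext (tokenScore_eq_eval e k)
  have h2 : score (d := d) x = fun θ => MvPolynomial.eval θ (scorePoly d x) :=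
    funext (score_eq_eval x)
  -- A sum over `Unit` turns bilinearity into linearity in the second argument.
  have h3 := polyNTK_sum (Finset.univ : Finset Unit) (Finset.univ : Finset (Fin T))
    (fun _ => wordPoly d e (tokenWord k)) fun l => wordPoly d (x l.rev) (tokenWord l)
  simp only [Finset.univ_unique, Finset.sum_singleton] at h3
  rw [h1, h2, ntk_eval, ← map_sum, ← h3]
  rfl

lemma ntk_score_score {d T' T : ℕ} (x' : Fin T' → V) (x : Fin T → V) (θ : Params V d) :
    ntk (score (d := d) x') (score (d := d) x) θ
      = ∑ k : Fin T', ntk (tokenScore (d := d) (x' k.rev) k) (score (d := d) x) θ := by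
  have h1 : score (d := d) x' = fun θ => MvPolynomial.eval θ (scorePoly d x') :=
    funext (score_eq_eval x')
  have h2 : score (d := d) x = fun θ => MvPolynomial.eval θ (scorePoly d x) :=
    funext (score_eq_eval x)
  simp only [ntk_tokenScore_score]
  rw [h1, h2, ntk_eval]
  simp only [← map_sum]
  exact congrArg _ (polyNTK_sum _ _ _ _)

lemma convergesInProb_ntk_token (σv σe σw σh : ℝ) (e : V) (k : ℕ) {T : ℕ} (x : Fin T → V) :
    ConvergesInProb (initLaw V σv σe σw σh)
      (fun d θ => ntk (tokenScore (d := d) e k) (score (d := d) x) θ)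
      (rho σv σe σw σh k * (oneHot e ⬝ᵥ oneHotFromEnd x k)) := by
  rw [← sum_rho_token]
  simp only [ntk_tokenScore_score]
  exact convergesInProb_sum _ fun l _ =>
    convergesInProb_polyNTK_tokenWord σv σe σw σh e (x l.rev) k l

/-- Distances `k ≥ T` drop out because `oneHotFromEnd x k` is zero there, and the last sum may start
at `1` because of its factor `k`. -/
lemma sum_rho_eq (σv σe σw σh : ℝ) {T' T : ℕ} (x' : Fin T' → V) (x : Fin T → V) :
    ∑ k : Fin T', rho σv σe σw σh k * (oneHot (x' k.rev) ⬝ᵥ oneHotFromEnd x k)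
      = (∑ k ∈ Finset.range (min T' T), σh ^ (2 * k) * σe ^ 2 * σw ^ 2 *
            (oneHotFromEnd x' k ⬝ᵥ oneHotFromEnd x k))
          + (∑ k ∈ Finset.range (min T' T), σh ^ (2 * k) * σv ^ 2 * σw ^ 2 *
            (oneHotFromEnd x' k ⬝ᵥ oneHotFromEnd x k))
          + (∑ k ∈ Finset.range (min T' T), σh ^ (2 * k) * σv ^ 2 * σe ^ 2 *
            (oneHotFromEnd x' k ⬝ᵥ oneHotFromEnd x k))
          + (∑ k ∈ Finset.Ico 1 (min T' T), (k : ℝ) * σh ^ (2 * k - 2) * σv ^ 2 * σw ^ 2 * σe ^ 2 *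
            (oneHotFromEnd x' k ⬝ᵥ oneHotFromEnd x k)) := by
  have hIco : (∑ k ∈ Finset.Ico 1 (min T' T),
      (k : ℝ) * σh ^ (2 * k - 2) * σv ^ 2 * σw ^ 2 * σe ^ 2 *
        (oneHotFromEnd x' k ⬝ᵥ oneHotFromEnd x k))
      = ∑ k ∈ Finset.range (min T' T),
      (k : ℝ) * σh ^ (2 * k - 2) * σv ^ 2 * σw ^ 2 * σe ^ 2 *
        (oneHotFromEnd x' k ⬝ᵥ oneHotFromEnd x k) := by
    refine Finset.sum_subset (fun k hk => ?_) fun k hk hk' => ?_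
    · simp only [Finset.mem_Ico, Finset.mem_range] at hk ⊢
      exact hk.2
    · have : k = 0 := by
        simp only [Finset.mem_Ico, Finset.mem_range] at hk hk'
        omega
      simp [this]
  rw [hIco, ← Finset.sum_add_distrib, ← Finset.sum_add_distrib, ← Finset.sum_add_distrib]
  simp only [← oneHotFromEnd_val]
  rw [Fin.sum_univ_eq_sum_range (fun k => rho σv σe σw σh k *
    (oneHotFromEnd x' k ⬝ᵥ oneHotFromEnd x k)) T']
  have hsub : Finset.range (min T' T) ⊆ Finset.range T' :=
    Finset.range_subset_range.2 (min_le_left _ _)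
  rw [← Finset.sum_subset hsub]
  · refine Finset.sum_congr rfl fun k _ => ?_
    rw [rho]
    ring
  · intro k hk hk'
    rw [oneHotFromEnd_of_le x]
    · simp
    · simp only [Finset.mem_range] at hk hk'
      omega

end KernelLimits

end LRNN

end

theorem lemmaA3 {V : Type*} [Fintype V] [DecidableEq V] (σv σe σw σh : ℝ) :
    (∀ (T' T : ℕ) (x' : Fin T' → V) (x : Fin T → V),
      LRNN.ConvergesInProb (LRNN.initLaw V σv σe σw σh)
        (fun d θ => LRNN.ntk (LRNN.score (d := d) x') (LRNN.score (d := d) x) θ)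
        ((∑ k ∈ Finset.range (min T' T), σh ^ (2 * k) * σe ^ 2 * σw ^ 2 *
            (LRNN.oneHotFromEnd x' k ⬝ᵥ LRNN.oneHotFromEnd x k))
          + (∑ k ∈ Finset.range (min T' T), σh ^ (2 * k) * σv ^ 2 * σw ^ 2 *
            (LRNN.oneHotFromEnd x' k ⬝ᵥ LRNN.oneHotFromEnd x k))
          + (∑ k ∈ Finset.range (min T' T), σh ^ (2 * k) * σv ^ 2 * σe ^ 2 *
            (LRNN.oneHotFromEnd x' k ⬝ᵥ LRNN.oneHotFromEnd x k))
          + (∑ k ∈ Finset.Ico 1 (min T' T), (k : ℝ) * σh ^ (2 * k - 2) * σv ^ 2 * σw ^ 2 * σe ^ 2 *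
            (LRNN.oneHotFromEnd x' k ⬝ᵥ LRNN.oneHotFromEnd x k)))) ∧
    (∀ (e : V) (k T : ℕ) (x : Fin T → V),
      LRNN.ConvergesInProb (LRNN.initLaw V σv σe σw σh)
        (fun d θ => LRNN.ntk (LRNN.tokenScore (d := d) e k) (LRNN.score (d := d) x) θ)
        (LRNN.rho σv σe σw σh k * (LRNN.oneHot e ⬝ᵥ LRNN.oneHotFromEnd x k))) := by
  refine ⟨fun T' T x' x => ?_, fun e k T x =>
    LRNN.convergesInProb_ntk_token σv σe σw σh e k x⟩
  -- The instance kernel is the sum of the token kernels over the tokens of `x'`, so its limit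
  -- follows from that of the token kernels.
  rw [← LRNN.sum_rho_eq]
  simp only [LRNN.ntk_score_score]
  exact LRNN.convergesInProb_sum _ fun k _ =>
    LRNN.convergesInProb_ntk_token σv σe σw σh (x' k.rev) k x
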